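/- Setting. Let $X_1,X_2,\dots$ be independent real random variables observed sequentially, and let $\mathcal F_k=\sigma(X_1,\dots,X_k)$ ($\mathcal F_0$ trivial). Let $\lambda>0$, and for every real $\gamma>0$ let $\lambda_\gamma>0$ with $\lambda_\gamma\neq\lambda$ and $\lambda_\gamma\to\lambda$ as $\gamma\to\infty$. For fixed $\gamma$ and $t\in\{1,2,\dots\}\cup\{\infty\}$, let $\mathbb P_t$ (expectation $\mathbb E_t$) be the law under which $X_k$ has the exponential density $q(x)=\lambda e^{-\lambda x}$, $x\ge 0$, for $k<t$, and the exponential density $q_\gamma(x)=\lambda_\gamma e^{-\lambda_\gamma x}$, $x\ge0$, for $k\ge t$. For a (possibly infinite-valued) stopping time $T$ of $(\mathcal F_k)$ put $$d(T)=\sup_{t\ge1}\ \operatorname{ess\,sup}\ \mathbb E_t\big[(T-t+1)^+\,\big|\,\mathcal F_{t-1}\big],\qquad n(\gamma)=\inf\{d(T):\ T \text{ a stopping time with } \mathbb E_\infty[T]\ge\gamma\},$$ the optimal worst-case average detection delay. Let $W_{-1}$ be the branch of the Lambert function which assigns to $x\in[-e^{-1},0)$ the unique solution $w\le -1$ of $we^w=x$,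 and for $y>0$ let $$G(y)=e^{1+y+W_{-1}(-e^{-1-y})}-W_{-1}(-e^{-1-y})-y-2 .$$ Write $f(\gamma)\sim g(\gamma)$ if $f(\gamma)/g(\gamma)\to1$ as $\gamma\to\infty$. Proposition. $n(\gamma)$ is finite for every $\gamma>0$, and as $\gamma\to\infty$: 1. if $\sqrt\gamma\,|1-\lambda_\gamma/\lambda|\to\infty$, then $$n(\gamma)\sim\frac{2\log\left(\tfrac12\gamma(1-\lambda_\gamma/\lambda)^2\right)}{(1-\lambda/\lambda_\gamma)^2};$$ 2. if $\sqrt\gamma\,|1-\lambda_\gamma/\lambda|\to y\in(0,\infty)$, then $$n(\gamma)\sim\gamma\,\frac{G(y^2/2)}{y^2/2};$$ 3. if $\sqrt\gamma\,|1-\lambda_\gamma/\lambda|\to0$, then $n(\gamma)\sim\gamma$. -/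

import Mathlib

open MeasureTheory ProbabilityTheory Filter Asymptotics
open scoped ENNReal Topology

namespace QuickestChange

/-- The law of the observations `X₁, X₂, …` when the change occurs at time `t`, on the canonical
space of real sequences, where the observation `X_{i+1}` is the coordinate `ω i`.
The observations are independent, `X_k` has law `Q₀` if `k < t` and law `Q₁` if `t ≤ k`;
`t = ⊤` means that no change ever occurs. -/
noncomputable def changeLaw (Q₀ Q₁ : Measure ℝ) (t : ℕ∞) : Measure (ℕ → ℝ) :=
  Measure.infinitePi fun i : ℕ => if ((i + 1 : ℕ) : ℕ∞) < t then Q₀ else Q₁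

/-- The filtration `ℱ k = σ(X₁, …, X_k)`, with `X_{i+1} = ω i` (`ℱ 0` is trivial). -/
def obsFiltration : Filtration ℕ (inferInstance : MeasurableSpace (ℕ → ℝ)) where
  seq k := ⨆ (i : ℕ) (_ : i < k), MeasurableSpace.comap (fun ω : ℕ → ℝ => ω i) inferInstance
  mono' _ _ hkl := iSup₂_le fun i hi =>
    le_iSup₂_of_le (f := fun (i : ℕ) (_ : i < _) =>
      MeasurableSpace.comap (fun ω : ℕ → ℝ => ω i) inferInstance) i (lt_of_lt_of_le hi hkl) le_rfl
  le' _ := iSup₂_le fun i _ => (measurable_pi_apply i).comap_le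

/-- Extended stopping times of the observation filtration. -/
def IsObsStoppingTime (T : (ℕ → ℝ) → ℕ∞) : Prop :=
  IsStoppingTime obsFiltration T

/-- The mean time to false alarm `𝔼_∞[T]`. -/
noncomputable def meanTimeToFalseAlarm (Q₀ Q₁ : Measure ℝ) (T : (ℕ → ℝ) → ℕ∞) : ℝ≥0∞ :=
  ∫⁻ ω, (T ω : ℝ≥0∞) ∂(changeLaw Q₀ Q₁ ⊤)

/-- The worst-case detection delay
`d(T) = sup_{t ≥ 1} ess sup 𝔼_t[(T - t + 1)⁺ | ℱ_{t-1}]`.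
The subtraction in `[0, ∞]` is truncated at `0`, so that `T + 1 - t` is `(T - t + 1)⁺`. -/
noncomputable def worstCaseDelay (Q₀ Q₁ : Measure ℝ) (T : (ℕ → ℝ) → ℕ∞) : ℝ≥0∞ :=
  ⨆ (t : ℕ) (_ : 1 ≤ t),
    essSup
      (condLExp (obsFiltration (t - 1)) (changeLaw Q₀ Q₁ t)
        (fun ω => (T ω : ℝ≥0∞) + 1 - (t : ℝ≥0∞)))
      (changeLaw Q₀ Q₁ t)

/-- The optimal worst-case detection delay
`n(γ) = inf {d(T) : T a stopping time with 𝔼_∞[T] ≥ γ}`. -/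
noncomputable def optimalDelay (Q₀ Q₁ : Measure ℝ) (γ : ℝ) : ℝ≥0∞ :=
  ⨅ (T : (ℕ → ℝ) → ℕ∞) (_ : IsObsStoppingTime T)
    (_ : ENNReal.ofReal γ ≤ meanTimeToFalseAlarm Q₀ Q₁ T), worstCaseDelay Q₀ Q₁ T

/-- The branch `W₋₁` of the Lambert function: for `-e⁻¹ ≤ x < 0`, the set below has exactly one
element, the solution `w ≤ -1` of `w e^w = x`. -/
noncomputable def lambertWNegOne (x : ℝ) : ℝ :=
  sInf {w : ℝ | w ≤ -1 ∧ w * Real.exp w = x}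

/-- `G(y) = exp(1 + y + W₋₁(-e^{-1-y})) - W₋₁(-e^{-1-y}) - y - 2`. -/
noncomputable def G (y : ℝ) : ℝ :=
  Real.exp (1 + y + lambertWNegOne (-Real.exp (-1 - y)))
    - lambertWNegOne (-Real.exp (-1 - y)) - y - 2

end QuickestChange

/-! Write `g y = e^y - y - 1` (`expGap`), `I₀ = -E z` under `Q₀` and `I₁ = E z` under `Q₁` for the
log-likelihood ratio `z`, and `q = (1 - λ_γ/λ)²/2`. As `λ_γ → λ` both informations are asymptotic to
`q`, while the fourth moments of `z` are `O(q²)`, so single jumps become negligible. Page's CUSUM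
time with threshold `ν` then has mean time to false alarm about `g(ν)/q` and worst-case delay about
`g(-ν)/q`, and it is nearly optimal. Hence `n(γ) q ≈ g(-ν)` where `g(ν) = γ q`. The Lambert function
enters because `w = -e^ν` solves `w e^w = -e^{-1-g(ν)}`, so that `G(g(ν)) = g(-ν)` (`G_expGap`). If
`γ q → ∞`, then `g(-ν) ~ ν ~ log(γ q)`; if `γ q → y²/2`, continuity of `g` suffices.

Upper bound (`optimalDelay_le`): before the change `g(W)` has drift at most `I₀` along the CUSUM
statistic `W`, and after it a shifted and capped version of `g(-W)` has drift almost `I₁`. Optional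
stopping turns these into bounds on the two expectations.

Lower bound (`le_optimalDelay`), for an arbitrary `T`: let `W` be frozen at `T` and `X = E_∞
e^{W_N}`. The number `e^{W_k}` is a combination of the likelihood ratios of all change points `s ≤
k`, with weights known at time `s`. Averaging the delay bounds over the change points with these
weights gives `∑_{k<N} E_∞[e^{W_k}; k < T] ≤ d(T) X` (`sum_exp_cusum_le`). The function `h(v) = (v -
1)e^v + 1` (`tiltedGap`) has drift at most `I₁ e^v`, so `E_∞ h(W_N) ≤ I₁ d(T) X`, whereas a small
shift of `g` has drift almost `I₀` and so controls `E_∞[T ∧ N]`. The inequality `g(-ν)e^v + g(v) ≤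
h(v) + g(ν)` (`lagrangian_le`), an equality at `v = ν`, combines the two, and `X` cancels.

When `γ q → 0` the shift error swamps `g(-ν)`, so a separate argument is used: the constant time
`⌈γ⌉` gives the upper bound, and `e^v ≤ 1 + s e^v + h(v)/s` forces `X` to be close to `1` whenever
`I₁ d(T)` is small, which makes `E_∞ T ≤ d(T) X` the lower bound (`mul_le_optimalDelay`). -/

namespace QuickestChange

/-! ### Measurability with respect to finitely many observations -/

/-- The path `ω` with all observations after the first `k` replaced by `0`. -/
def truncPath (k : ℕ) (ω : ℕ → ℝ) : ℕ → ℝ := fun i => if i < k then ω i else 0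

lemma measurable_truncPath (k : ℕ) : Measurable (truncPath k) := by
  refine measurable_pi_lambda _ fun i => ?_
  by_cases h : i < k <;> simp only [truncPath, h, if_true, if_false] <;> fun_prop

lemma measurable_eval_obsFiltration {i k : ℕ} (h : i < k) :
    Measurable[obsFiltration k] (fun ω : ℕ → ℝ => ω i) :=
  Measurable.of_comap_le (le_iSup₂_of_le (f := fun (i : ℕ) (_ : i < k) =>
    MeasurableSpace.comap (fun ω : ℕ → ℝ => ω i) inferInstance) i h le_rfl)

/-- Truncation does not alter the generating coordinates. Passing through the invariant σ-algebra
turns measurability at time `k` into a pointwise identity, with no exceptional null set. -/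
lemma obsFiltration_le_invariants (k : ℕ) :
    obsFiltration k ≤ MeasurableSpace.invariants (truncPath k) := by
  refine iSup₂_le fun i hi => ?_
  rintro _ ⟨s, hs, rfl⟩
  refine ⟨measurable_pi_apply i hs, ?_⟩
  ext ω
  simp [truncPath, hi]

lemma apply_truncPath {β : Type*} [MeasurableSpace β] [MeasurableSingletonClass β] {k : ℕ}
    {f : (ℕ → ℝ) → β} (hf : Measurable[obsFiltration k] f) (ω : ℕ → ℝ) :
    f (truncPath k ω) = f ω := by
  have h : Measurable[MeasurableSpace.invariants (truncPath k)] f :=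
    hf.mono (obsFiltration_le_invariants k) le_rfl
  exact congrFun (MeasurableSpace.comp_eq_of_measurable_invariants h) ω

lemma measurable_obsFiltration_of_truncPath {β : Type*} [MeasurableSpace β] {k : ℕ}
    {f : (ℕ → ℝ) → β} (hf : Measurable f) (h : ∀ ω, f (truncPath k ω) = f ω) :
    Measurable[obsFiltration k] f := by
  have : f = f ∘ truncPath k := funext fun ω => (h ω).symm
  rw [this]
  refine hf.comp ((@measurable_pi_iff _ _ _ (obsFiltration k) _ _).2 fun i => ?_)
  by_cases hi : i < k
  · simpa only [truncPath, hi, if_true] using measurable_eval_obsFiltration hi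
  · simp only [truncPath, hi, if_false]
    exact measurable_const

/-! ### Integrating out one observation under a product law -/

section InfinitePi

variable {μ : ℕ → Measure ℝ} [∀ i, IsProbabilityMeasure (μ i)]

lemma indepFun_truncPath_eval (k : ℕ) :
    IndepFun (truncPath k) (fun ω : ℕ → ℝ => ω k) (Measure.infinitePi μ) := by
  have hi : iIndepFun (fun (i : ℕ) (ω : ℕ → ℝ) => ω i) (Measure.infinitePi μ) :=
    iIndepFun_infinitePi (X := fun _ x => x) (fun _ => measurable_id)
  have h := hi.indepFun_finset (Finset.range k) {k} (by simp) (fun i => measurable_pi_apply i)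
  have h1 : Measurable fun (u : Finset.range k → ℝ) (i : ℕ) =>
      if hi : i < k then u ⟨i, Finset.mem_range.2 hi⟩ else 0 := by
    refine measurable_pi_lambda _ fun i => ?_
    by_cases h : i < k <;> simp only [h, dif_pos, dif_neg, not_false_eq_true] <;> fun_prop
  have h2 : Measurable fun u : ({k} : Finset ℕ) → ℝ => u ⟨k, by simp⟩ := by fun_prop
  convert! h.comp h1 h2 using 1

/-- The observation `ω k` may be integrated out before the first `k` ones. -/
lemma lintegral_eval_eq (k : ℕ) {F : (ℕ → ℝ) → ℝ → ℝ≥0∞} (hF : Measurable (Function.uncurry F))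
    (hFk : ∀ ω x, F (truncPath k ω) x = F ω x) :
    ∫⁻ ω, F ω (ω k) ∂Measure.infinitePi μ =
      ∫⁻ ω, ∫⁻ x, F ω x ∂μ k ∂Measure.infinitePi μ := by
  have h := (indepFun_iff_map_prod_eq_prod_map_map (measurable_truncPath k).aemeasurable
    (measurable_pi_apply k).aemeasurable).1 (indepFun_truncPath_eval (μ := μ) k)
  have hk : (Measure.infinitePi μ).map (fun ω : ℕ → ℝ => ω k) = μ k := Measure.infinitePi_map_eval μ k
  calc ∫⁻ ω, F ω (ω k) ∂Measure.infinitePi μ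
      = ∫⁻ ω, Function.uncurry F (truncPath k ω, ω k) ∂Measure.infinitePi μ := by
        simp [Function.uncurry, hFk]
    _ = ∫⁻ p, Function.uncurry F p
          ∂(Measure.infinitePi μ).map (fun ω => (truncPath k ω, ω k)) := by
        rw [lintegral_map hF ((measurable_truncPath k).prodMk (measurable_pi_apply k))]
    _ = ∫⁻ ω, ∫⁻ x, F ω x ∂μ k ∂Measure.infinitePi μ := by
        rw [h, hk, lintegral_prod _ hF.aemeasurable, lintegral_map _ (measurable_truncPath k)]
        · simp [Function.uncurry, hFk]
        · exact hF.lintegral_prod_right'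

lemma truncPath_succ_update (k : ℕ) (ω : ℕ → ℝ) (x : ℝ) :
    truncPath (k + 1) (Function.update ω k x) = Function.update (truncPath k ω) k x := by
  funext i
  rcases lt_trichotomy i k with h | rfl | h
  · simp [truncPath, Function.update_of_ne h.ne, h, Nat.lt_succ_of_lt h]
  · simp [truncPath]
  · simp [truncPath, Function.update_of_ne h.ne', h.not_ge, h.not_gt]

lemma lintegral_update_eq (k : ℕ) {f : (ℕ → ℝ) → ℝ≥0∞}
    (hf : Measurable[obsFiltration (k + 1)] f) :
    ∫⁻ ω, f ω ∂Measure.infinitePi μ =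
      ∫⁻ ω, ∫⁻ x, f (Function.update ω k x) ∂μ k ∂Measure.infinitePi μ := by
  have hm : Measurable f := hf.mono (obsFiltration.le _) le_rfl
  rw [← lintegral_eval_eq k (F := fun ω x => f (Function.update ω k x))]
  · simp
  · exact hm.comp (by fun_prop)
  · intro ω x
    rw [← truncPath_succ_update, apply_truncPath hf]

lemma measurable_lintegral_update (k : ℕ) {f : (ℕ → ℝ) → ℝ≥0∞}
    (hf : Measurable[obsFiltration (k + 1)] f) (Q : Measure ℝ) [SFinite Q] :
    Measurable[obsFiltration k] fun ω => ∫⁻ x, f (Function.update ω k x) ∂Q := by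
  have hm : Measurable f := hf.mono (obsFiltration.le _) le_rfl
  refine measurable_obsFiltration_of_truncPath ?_ fun ω => ?_
  · exact Measurable.lintegral_prod_right' (f := fun p : (ℕ → ℝ) × ℝ => f (Function.update p.1 k p.2))
      (hm.comp (by fun_prop))
  · refine lintegral_congr fun x => ?_
    rw [← truncPath_succ_update, apply_truncPath hf]

end InfinitePi

/-! ### Stopping times as sums of survival indicators -/

section Counting

lemma sum_survival_of_nat (n s N : ℕ) :
    ∑ k ∈ Finset.Ico s N, (if (k : ℕ∞) < (n : ℕ∞) then (1 : ℝ≥0∞) else 0) =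
      ((min n N - s : ℕ) : ℝ≥0∞) := by
  have h : (Finset.Ico s N).filter (fun k => k < n) = Finset.Ico s (min n N) := by
    ext k; simp only [Finset.mem_filter, Finset.mem_Ico]; omega
  simp only [Nat.cast_lt]
  rw [← Finset.sum_filter, h]
  simp

lemma sum_survival_top (s N : ℕ) :
    ∑ k ∈ Finset.Ico s N, (if (k : ℕ∞) < ⊤ then (1 : ℝ≥0∞) else 0) = ((N - s : ℕ) : ℝ≥0∞) := by
  simp

lemma iSup_sum_survival (τ : ℕ∞) (s : ℕ) :
    ⨆ N : ℕ, ∑ k ∈ Finset.Ico s N, (if (k : ℕ∞) < τ then (1 : ℝ≥0∞) else 0) =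
      (τ : ℝ≥0∞) - s := by
  induction τ using ENat.recTopCoe with
  | top =>
    simp only [sum_survival_top, ENat.toENNReal_top, ENNReal.top_sub (ENNReal.natCast_ne_top s)]
    refine eq_top_iff.2 ?_
    rw [← ENNReal.iSup_natCast]
    refine iSup_le fun n => le_iSup_of_le (n + s) ?_
    simp
  | coe n =>
    simp only [sum_survival_of_nat, ENat.toENNReal_coe, ← ENNReal.natCast_sub]
    refine le_antisymm (iSup_le fun N => ?_) (le_iSup_of_le n ?_)
    · exact_mod_cast Nat.sub_le_sub_right (min_le_left _ _) _
    · simp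

lemma iSup_sum_survival_range (τ : ℕ∞) :
    ⨆ N : ℕ, ∑ k ∈ Finset.range N, (if (k : ℕ∞) < τ then (1 : ℝ≥0∞) else 0) = (τ : ℝ≥0∞) := by
  simpa using iSup_sum_survival τ 0

/-- The change time is written `t = s + 1`, so that conditioning is on `obsFiltration s` and the
delay counts the `k ≥ s` with `k < τ`. Truncation at `N` keeps every expectation finite until a
final monotone limit. -/
lemma delay_eq (τ : ℕ∞) (s : ℕ) :
    (τ : ℝ≥0∞) + 1 - ((s + 1 : ℕ) : ℝ≥0∞) =
      ⨆ N : ℕ, ∑ k ∈ Finset.Ico s N, (if (k : ℕ∞) < τ then (1 : ℝ≥0∞) else 0) := by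
  rw [iSup_sum_survival]
  push_cast
  exact ENNReal.add_sub_add_eq_sub_right (by simp)

lemma monotone_sum_survival (τ : ℕ∞) (s : ℕ) :
    Monotone fun N : ℕ => ∑ k ∈ Finset.Ico s N, (if (k : ℕ∞) < τ then (1 : ℝ≥0∞) else 0) :=
  fun _ _ h => Finset.sum_le_sum_of_subset (Finset.Ico_subset_Ico_right h)

end Counting

section StoppingTime

variable {T : (ℕ → ℝ) → ℕ∞}

lemma measurableSet_survival (hT : IsObsStoppingTime T) (k : ℕ) :
    MeasurableSet[obsFiltration k] {ω | (k : ℕ∞) < T ω} :=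
  IsStoppingTime.measurableSet_gt hT k

lemma measurable_survival (hT : IsObsStoppingTime T) (k : ℕ) :
    Measurable[obsFiltration k] fun ω => if (k : ℕ∞) < T ω then (1 : ℝ≥0∞) else 0 :=
  Measurable.ite (measurableSet_survival hT k) measurable_const measurable_const

lemma measurable_survival' (hT : IsObsStoppingTime T) (k : ℕ) :
    Measurable fun ω => if (k : ℕ∞) < T ω then (1 : ℝ≥0∞) else 0 :=
  (measurable_survival hT k).mono (obsFiltration.le k) le_rfl

lemma measurable_sum_survival (hT : IsObsStoppingTime T) (s N : ℕ) :
    Measurable fun ω => ∑ k ∈ Finset.Ico s N, (if (k : ℕ∞) < T ω then (1 : ℝ≥0∞) else 0) :=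
  Finset.measurable_fun_sum _ fun k _ => measurable_survival' hT k

lemma measurable_delay (hT : IsObsStoppingTime T) (s : ℕ) :
    Measurable fun ω => (T ω : ℝ≥0∞) + 1 - ((s + 1 : ℕ) : ℝ≥0∞) := by
  simp only [delay_eq]
  exact Measurable.iSup fun N => measurable_sum_survival hT s N

lemma lintegral_iSup_sum_survival (hT : IsObsStoppingTime T) (P : Measure (ℕ → ℝ)) :
    ∫⁻ ω, (T ω : ℝ≥0∞) ∂P = ⨆ N : ℕ,
      ∫⁻ ω, ∑ k ∈ Finset.range N, (if (k : ℕ∞) < T ω then (1 : ℝ≥0∞) else 0) ∂P := by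
  simp only [← iSup_sum_survival_range]
  refine lintegral_iSup (fun N => ?_) fun M N h ω => ?_
  · simpa using measurable_sum_survival hT 0 N
  · simpa using monotone_sum_survival (T ω) 0 h

end StoppingTime

/-! ### The essential supremum as a family of integral inequalities -/

section WorstCaseDelay

variable {Q₀ Q₁ : Measure ℝ} [IsProbabilityMeasure Q₀] [IsProbabilityMeasure Q₁]
  {T : (ℕ → ℝ) → ℕ∞}

instance isProbabilityMeasure_ite (p : Prop) [Decidable p] :
    IsProbabilityMeasure (if p then Q₀ else Q₁) := by
  split_ifs <;> infer_instance

instance isProbabilityMeasure_changeLaw (t : ℕ∞) : IsProbabilityMeasure (changeLaw Q₀ Q₁ t) := by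
  unfold changeLaw; infer_instance

lemma worstCaseDelay_le {C : ℝ≥0∞}
    (h : ∀ (s : ℕ) (A : Set (ℕ → ℝ)), MeasurableSet[obsFiltration s] A →
      ∫⁻ ω in A, ((T ω : ℝ≥0∞) + 1 - ((s + 1 : ℕ) : ℝ≥0∞)) ∂changeLaw Q₀ Q₁ ((s + 1 : ℕ) : ℕ∞) ≤
        C * changeLaw Q₀ Q₁ ((s + 1 : ℕ) : ℕ∞) A) :
    worstCaseDelay Q₀ Q₁ T ≤ C := by
  refine iSup₂_le fun t ht => ?_
  obtain ⟨s, rfl⟩ : ∃ s, t = s + 1 := ⟨t - 1, by omega⟩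
  refine essSup_le_of_ae_le _ (ae_le_of_ae_le_trim (hm := obsFiltration.le s) ?_)
  refine ae_le_of_forall_setLIntegral_le_of_sigmaFinite (measurable_condLExp _ _ _) fun A hA _ => ?_
  have := setLIntegral_condLExp_trim (obsFiltration.le s) (changeLaw Q₀ Q₁ ((s + 1 : ℕ) : ℕ∞))
    (fun ω => (T ω : ℝ≥0∞) + 1 - ((s + 1 : ℕ) : ℝ≥0∞)) hA
  simp only [Nat.add_sub_cancel]
  rw [this, setLIntegral_const, trim_measurableSet_eq _ hA]
  exact h s A hA

/-- The direction used for lower bounds: the essential supremum may be tested against any weight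
known at time `s`, in particular against the CUSUM deficit. -/
lemma lintegral_mul_delay_le (hT : IsObsStoppingTime T) (s : ℕ) {f : (ℕ → ℝ) → ℝ≥0∞}
    (hf : Measurable[obsFiltration s] f) :
    ∫⁻ ω, f ω * ((T ω : ℝ≥0∞) + 1 - ((s + 1 : ℕ) : ℝ≥0∞))
        ∂changeLaw Q₀ Q₁ ((s + 1 : ℕ) : ℕ∞) ≤
      worstCaseDelay Q₀ Q₁ T * ∫⁻ ω, f ω ∂changeLaw Q₀ Q₁ ((s + 1 : ℕ) : ℕ∞) := by
  set P := changeLaw Q₀ Q₁ ((s + 1 : ℕ) : ℕ∞) with hP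
  set X : (ℕ → ℝ) → ℝ≥0∞ := fun ω => (T ω : ℝ≥0∞) + 1 - ((s + 1 : ℕ) : ℝ≥0∞) with hX
  have hXm : Measurable X := measurable_delay hT s
  have hle : ∀ᵐ ω ∂P, condLExp (obsFiltration s) P X ω ≤ worstCaseDelay Q₀ Q₁ T := by
    filter_upwards [ENNReal.ae_le_essSup (μ := P) (condLExp (obsFiltration s) P X)] with ω hω
    exact hω.trans (le_iSup₂_of_le (f := fun (t : ℕ) (_ : 1 ≤ t) => essSup
      (condLExp (obsFiltration (t - 1)) (changeLaw Q₀ Q₁ t)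
        (fun ω => (T ω : ℝ≥0∞) + 1 - (t : ℝ≥0∞))) (changeLaw Q₀ Q₁ t)) (s + 1) (by omega) le_rfl)
  have hm := obsFiltration.le s
  -- Phrased as a comparison of measures on the past, the bound passes from sets to arbitrary
  -- weights at once.
  have key : (P.withDensity X).trim hm ≤ worstCaseDelay Q₀ Q₁ T • P.trim hm := by
    refine Measure.le_iff.2 fun A hA => ?_
    rw [trim_measurableSet_eq hm hA, withDensity_apply _ (hm A hA),
      ← setLIntegral_condLExp hm P X hA, Measure.smul_apply, trim_measurableSet_eq hm hA,
      smul_eq_mul, ← setLIntegral_const]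
    exact setLIntegral_mono_ae measurable_const.aemeasurable (hle.mono fun ω h _ => h)
  have hf' : Measurable f := hf.mono hm le_rfl
  calc ∫⁻ ω, f ω * X ω ∂P = ∫⁻ ω, f ω ∂(P.withDensity X) := by
        rw [lintegral_withDensity_eq_lintegral_mul _ hXm hf']
        simp [mul_comm]
    _ = ∫⁻ ω, f ω ∂(P.withDensity X).trim hm := (lintegral_trim hm hf).symm
    _ ≤ ∫⁻ ω, f ω ∂(worstCaseDelay Q₀ Q₁ T • P.trim hm) := lintegral_mono' key le_rfl
    _ = _ := by rw [lintegral_smul_measure, lintegral_trim hm hf, smul_eq_mul]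

end WorstCaseDelay

/-! ### Drift inequalities for the stopped CUSUM statistic -/

/-- The CUSUM statistic with increments `z`, frozen from time `T` on. -/
noncomputable def cusum (z : ℝ → ℝ) (T : (ℕ → ℝ) → ℕ∞) : ℕ → (ℕ → ℝ) → ℝ
  | 0, _ => 0
  | k + 1, ω => if (k : ℕ∞) < T ω then max (cusum z T k ω + z (ω k)) 0 else cusum z T k ω

section Cusum

variable {z : ℝ → ℝ} {T : (ℕ → ℝ) → ℕ∞}

lemma cusum_nonneg (k : ℕ) (ω : ℕ → ℝ) : 0 ≤ cusum z T k ω := by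
  induction k with
  | zero => exact le_rfl
  | succ k ih =>
    rw [cusum]
    split_ifs
    exacts [le_max_right _ _, ih]

lemma cusum_eq_of_le {k : ℕ} {ω : ℕ → ℝ} (h : (k : ℕ∞) ≤ T ω) :
    cusum z T k ω = cusum z (fun _ => ⊤) k ω := by
  induction k with
  | zero => rfl
  | succ k ih =>
    have hk : (k : ℕ∞) < T ω := lt_of_lt_of_le (by exact_mod_cast Nat.lt_succ_self k) h
    simp [cusum, hk, ih hk.le]

lemma cusum_eq_of_ge {n k : ℕ} {ω : ℕ → ℝ} (h : T ω = n) (hk : n ≤ k) :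
    cusum z T k ω = cusum z (fun _ => ⊤) n ω := by
  induction k, hk using Nat.le_induction with
  | base => exact cusum_eq_of_le h.ge
  | succ k hk ih =>
    have : ¬ (k : ℕ∞) < T ω := by rw [h]; exact_mod_cast hk.not_gt
    rw [cusum, if_neg this, ih]

lemma isObsStoppingTime_top : IsObsStoppingTime fun _ => ⊤ := fun k => by simp

lemma measurable_cusum (hz : Measurable z) (hT : IsObsStoppingTime T) (k : ℕ) :
    Measurable[obsFiltration k] (cusum z T k) := by
  induction k with
  | zero => exact measurable_const
  | succ k ih =>
    have h1 : Measurable[obsFiltration (k + 1)] (cusum z T k) :=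
      ih.mono (obsFiltration.mono k.le_succ) le_rfl
    have h2 : Measurable[obsFiltration (k + 1)] fun ω : ℕ → ℝ => z (ω k) :=
      hz.comp (measurable_eval_obsFiltration k.lt_succ_self)
    exact Measurable.ite (obsFiltration.mono k.le_succ _ (measurableSet_survival hT k))
      ((h1.add h2).max measurable_const) h1

lemma measurable_cusum' (hz : Measurable z) (hT : IsObsStoppingTime T) (k : ℕ) :
    Measurable (cusum z T k) :=
  (measurable_cusum hz hT k).mono (obsFiltration.le k) le_rfl

variable {μ : ℕ → Measure ℝ} [∀ i, IsProbabilityMeasure (μ i)]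

/-- One-step conditioning for the frozen CUSUM statistic. -/
lemma lintegral_mul_cusum_succ (hz : Measurable z) (hT : IsObsStoppingTime T) (k : ℕ)
    {f : (ℕ → ℝ) → ℝ≥0∞} (hf : Measurable[obsFiltration k] f) {φ : ℝ → ℝ≥0∞} (hφ : Measurable φ) :
    ∫⁻ ω, f ω * φ (cusum z T (k + 1) ω) ∂Measure.infinitePi μ =
      ∫⁻ ω, f ω * (if (k : ℕ∞) < T ω then ∫⁻ x, φ (max (cusum z T k ω + z x) 0) ∂μ k
        else φ (cusum z T k ω)) ∂Measure.infinitePi μ := by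
  have hc := measurable_cusum' hz hT k
  have hS : MeasurableSet {ω | (k : ℕ∞) < T ω} := obsFiltration.le k _ (measurableSet_survival hT k)
  have hSk : ∀ ω, ((k : ℕ∞) < T (truncPath k ω)) = ((k : ℕ∞) < T ω) := fun ω => by
    have := ((obsFiltration_le_invariants k) _ (measurableSet_survival hT k)).2
    have h := Set.ext_iff.1 this ω
    exact propext h
  have hf' : Measurable f := hf.mono (obsFiltration.le k) le_rfl
  have h := lintegral_eval_eq (μ := μ) k (F := fun ω x => f ω *
    (if (k : ℕ∞) < T ω then φ (max (cusum z T k ω + z x) 0) else φ (cusum z T k ω))) ?_ ?_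
  · have e : ∀ ω, f ω * φ (cusum z T (k + 1) ω) = f ω * (if (k : ℕ∞) < T ω then
        φ (max (cusum z T k ω + z (ω k)) 0) else φ (cusum z T k ω)) := fun ω => by
      rw [cusum]; split_ifs <;> rfl
    simp only [e, h]
    refine lintegral_congr fun ω => ?_
    split_ifs with hk
    · exact lintegral_const_mul _ (hφ.comp (by fun_prop))
    · simp
  · refine Measurable.mul (by fun_prop) (Measurable.ite ?_ ?_ ?_)
    · exact measurable_fst hS
    · exact hφ.comp (by fun_prop)
    · exact hφ.comp (by fun_prop)
  · intro ω x
    simp only [apply_truncPath hf, hSk, apply_truncPath (measurable_cusum hz hT k)]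

/-- Freezing makes the increment vanish on `{T ≤ k}`, so the drift bound is charged only on
survival; summing it is optional stopping without any limit theorem for martingales. -/
lemma lintegral_cusum_succ_le (hz : Measurable z) (hT : IsObsStoppingTime T) (k : ℕ)
    {φ ρ : ℝ → ℝ≥0∞} (hφ : Measurable φ)
    (h : ∀ y, 0 ≤ y → ∫⁻ x, φ (max (y + z x) 0) ∂μ k ≤ φ y + ρ y) :
    ∫⁻ ω, φ (cusum z T (k + 1) ω) ∂Measure.infinitePi μ ≤
      ∫⁻ ω, φ (cusum z T k ω) ∂Measure.infinitePi μ +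
        ∫⁻ ω, (if (k : ℕ∞) < T ω then ρ (cusum z T k ω) else 0) ∂Measure.infinitePi μ := by
  have e := lintegral_mul_cusum_succ (μ := μ) hz hT k (f := fun _ => 1) measurable_const hφ
  simp only [one_mul] at e
  have hc := measurable_cusum' hz hT k
  rw [e, ← lintegral_add_left (by fun_prop : Measurable fun ω => φ (cusum z T k ω))]
  refine lintegral_mono fun ω => ?_
  simp only
  split_ifs
  · exact h _ (cusum_nonneg k ω)
  · simp

lemma lintegral_cusum_le_sum (hz : Measurable z) (hT : IsObsStoppingTime T) (N : ℕ)
    {φ ρ : ℝ → ℝ≥0∞} (hφ : Measurable φ)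
    (h : ∀ k y, 0 ≤ y → ∫⁻ x, φ (max (y + z x) 0) ∂μ k ≤ φ y + ρ y) :
    ∫⁻ ω, φ (cusum z T N ω) ∂Measure.infinitePi μ ≤ φ 0 + ∑ k ∈ Finset.range N,
        ∫⁻ ω, (if (k : ℕ∞) < T ω then ρ (cusum z T k ω) else 0) ∂Measure.infinitePi μ := by
  induction N with
  | zero => simp [cusum]
  | succ N ih =>
    rw [Finset.sum_range_succ, ← add_assoc]
    exact (lintegral_cusum_succ_le hz hT N hφ (h N)).trans (by gcongr)

lemma le_lintegral_mul_cusum_succ (hz : Measurable z) (hT : IsObsStoppingTime T) (k : ℕ)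
    {f : (ℕ → ℝ) → ℝ≥0∞} (hf : Measurable[obsFiltration k] f) {φ : ℝ → ℝ≥0∞} (hφ : Measurable φ)
    {c : ℝ≥0∞} (h : ∀ ω, (k : ℕ∞) < T ω → φ (cusum z T k ω) + c ≤
      ∫⁻ x, φ (max (cusum z T k ω + z x) 0) ∂μ k) :
    ∫⁻ ω, f ω * φ (cusum z T k ω) ∂Measure.infinitePi μ +
        c * ∫⁻ ω, f ω * (if (k : ℕ∞) < T ω then 1 else 0) ∂Measure.infinitePi μ ≤
      ∫⁻ ω, f ω * φ (cusum z T (k + 1) ω) ∂Measure.infinitePi μ := by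
  have hf' : Measurable f := hf.mono (obsFiltration.le k) le_rfl
  have hc := measurable_cusum' hz hT k
  have hS := measurable_survival' hT k
  rw [lintegral_mul_cusum_succ (μ := μ) hz hT k hf hφ,
    ← lintegral_const_mul _
      (by fun_prop : Measurable fun ω => f ω * if (k : ℕ∞) < T ω then (1 : ℝ≥0∞) else 0),
    ← lintegral_add_left (by fun_prop : Measurable fun ω => f ω * φ (cusum z T k ω))]
  refine lintegral_mono fun ω => ?_
  simp only
  split_ifs with hk
  · calc f ω * φ (cusum z T k ω) + c * (f ω * 1) = f ω * (φ (cusum z T k ω) + c) := by ring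
      _ ≤ _ := by gcongr; exact h ω hk
  · simp

/-- Optional stopping started at time `s`. The weight `f` stands for conditioning on the first `s`
observations. -/
lemma sum_le_lintegral_mul_cusum (hz : Measurable z) (hT : IsObsStoppingTime T) {s N : ℕ}
    (hsN : s ≤ N) {f : (ℕ → ℝ) → ℝ≥0∞} (hf : Measurable[obsFiltration s] f) {φ : ℝ → ℝ≥0∞}
    (hφ : Measurable φ) {c : ℝ≥0∞} (h : ∀ k, s ≤ k → ∀ ω, (k : ℕ∞) < T ω →
      φ (cusum z T k ω) + c ≤ ∫⁻ x, φ (max (cusum z T k ω + z x) 0) ∂μ k) :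
    ∫⁻ ω, f ω * φ (cusum z T s ω) ∂Measure.infinitePi μ + c * ∑ k ∈ Finset.Ico s N,
        ∫⁻ ω, f ω * (if (k : ℕ∞) < T ω then 1 else 0) ∂Measure.infinitePi μ ≤
      ∫⁻ ω, f ω * φ (cusum z T N ω) ∂Measure.infinitePi μ := by
  induction N, hsN using Nat.le_induction with
  | base => simp
  | succ N hN ih =>
    rw [Finset.sum_Ico_succ_top hN, mul_add, ← add_assoc]
    refine le_trans (by gcongr) (le_lintegral_mul_cusum_succ hz hT N
      (hf.mono (obsFiltration.mono hN) le_rfl) hφ (h N hN))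

end Cusum

/-! ### Page's stopping time: false alarms and delay -/

section CusumTime

/-- Page's CUSUM stopping time: the first time at which the CUSUM statistic reaches `ν`. -/
noncomputable def cusumTime (z : ℝ → ℝ) (ν : ℝ) : (ℕ → ℝ) → ℕ∞ :=
  hittingAfter (cusum z fun _ => ⊤) (Set.Ici ν) 0

variable {z : ℝ → ℝ} {ν : ℝ}

lemma isObsStoppingTime_cusumTime (hz : Measurable z) : IsObsStoppingTime (cusumTime z ν) :=
  Adapted.isStoppingTime_hittingAfter (fun k => measurable_cusum hz isObsStoppingTime_top k)
    measurableSet_Ici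

lemma cusum_lt_of_lt_cusumTime {k : ℕ} {ω : ℕ → ℝ} (h : (k : ℕ∞) < cusumTime z ν ω) :
    cusum z (cusumTime z ν) k ω < ν := by
  rw [cusum_eq_of_le h.le]
  exact not_le.1 (notMem_of_lt_hittingAfter h (Nat.zero_le k))

lemma le_cusum_of_cusumTime_le {k : ℕ} {ω : ℕ → ℝ} (h : ¬ (k : ℕ∞) < cusumTime z ν ω) :
    ν ≤ cusum z (cusumTime z ν) k ω := by
  have h' := not_lt.1 h
  have hne : cusumTime z ν ω ≠ ⊤ := ne_top_of_le_ne_top (ENat.natCast_ne_top k) h'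
  obtain ⟨n, hn⟩ := ENat.ne_top_iff_exists.1 hne
  rw [cusum_eq_of_ge hn.symm (by rw [← hn] at h'; exact_mod_cast h')]
  have := hittingAfter_mem_set_of_ne_top hne
  have e : (hittingAfter (cusum z fun _ => ⊤) (Set.Ici ν) 0 ω).untopA = n := by
    change WithTop.untopA (cusumTime z ν ω) = n
    rw [← hn]; rfl
  rw [e] at this
  exact this

variable {Q₀ Q₁ : Measure ℝ} [IsProbabilityMeasure Q₀] [IsProbabilityMeasure Q₁]

/-- The mean of `φ` grows by at most `I` per survived step, and `φ ≥ H` once the threshold has been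
reached. Paths still running at time `N` contribute an error that Markov's inequality bounds by `H *
(E / (N + 1))`, which vanishes when the mean `E` is finite. -/
lemma le_mul_meanTimeToFalseAlarm_cusumTime (hz : Measurable z) {φ : ℝ → ℝ≥0∞}
    (hφ : Measurable φ) (hφ0 : φ 0 = 0) {I H : ℝ≥0∞} (hI : I ≠ 0) (hH : H ≠ ∞)
    (h : ∀ y, 0 ≤ y → ∫⁻ x, φ (max (y + z x) 0) ∂Q₀ ≤ φ y + I) (hν : ∀ y, ν ≤ y → H ≤ φ y) :
    H ≤ I * meanTimeToFalseAlarm Q₀ Q₁ (cusumTime z ν) := by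
  set E := meanTimeToFalseAlarm Q₀ Q₁ (cusumTime z ν) with hE
  by_cases hEtop : E = ∞
  · rw [hEtop, ENNReal.mul_top hI]; exact le_top
  have hT : IsObsStoppingTime (cusumTime z ν) := isObsStoppingTime_cusumTime hz
  set P := changeLaw Q₀ Q₁ ⊤ with hP
  have key : ∀ N : ℕ, H ≤ I * E + H * (E / (N + 1 : ℕ)) := by
    intro N
    have h1 : ∫⁻ ω, φ (cusum z (cusumTime z ν) N ω) ∂P ≤ I * E := by
      have := lintegral_cusum_le_sum (μ := fun i : ℕ => if ((i + 1 : ℕ) : ℕ∞) < ⊤ then Q₀ else Q₁)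
        hz hT N (ρ := fun _ => I) hφ (fun k y hy => by simpa using h y hy)
      refine this.trans ?_
      rw [hφ0, zero_add, hE, meanTimeToFalseAlarm, lintegral_iSup_sum_survival hT]
      refine le_trans ?_ (mul_le_mul_right (le_iSup _ N) I)
      rw [lintegral_finsetSum _ fun k _ => measurable_survival' hT k, Finset.mul_sum]
      refine Finset.sum_le_sum fun k _ => ?_
      rw [← lintegral_const_mul _ (measurable_survival' hT k)]
      refine lintegral_mono fun ω => ?_
      simp only
      split_ifs <;> simp
    have h2 : ∫⁻ ω, (if (N : ℕ∞) < cusumTime z ν ω then (1 : ℝ≥0∞) else 0) ∂P ≤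
        E / (N + 1 : ℕ) := by
      rw [ENNReal.le_div_iff_mul_le (by simp) (by simp),
        ← lintegral_mul_const _ (measurable_survival' hT N)]
      refine lintegral_mono fun ω => ?_
      simp only
      split_ifs with hN
      · rw [one_mul]
        have : ((N + 1 : ℕ) : ℕ∞) ≤ cusumTime z ν ω := by
          push_cast; exact Order.add_one_le_of_lt hN
        simpa using ENat.toENNReal_le.2 this
      · simp
    calc H = ∫⁻ _, H ∂P := by simp
      _ ≤ ∫⁻ ω, (φ (cusum z (cusumTime z ν) N ω) +
            H * (if (N : ℕ∞) < cusumTime z ν ω then (1 : ℝ≥0∞) else 0)) ∂P := by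
          refine lintegral_mono fun ω => ?_
          simp only
          split_ifs with hN
          · simp
          · simpa using hν _ (le_cusum_of_cusumTime_le hN)
      _ ≤ I * E + H * (E / (N + 1 : ℕ)) := by
          have hc := measurable_cusum' hz hT N
          rw [lintegral_add_left
              (by fun_prop : Measurable fun ω => φ (cusum z (cusumTime z ν) N ω)),
            lintegral_const_mul _ (measurable_survival' hT N)]
          gcongr
  have hlim : Tendsto (fun N : ℕ => I * E + H * (E / (N + 1 : ℕ))) atTop
      (𝓝 (I * E + H * 0)) := by
    refine tendsto_const_nhds.add (ENNReal.Tendsto.const_mul ?_ (Or.inr hH))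
    exact (ENNReal.Tendsto.const_div (ENNReal.tendsto_nat_nhds_top.comp (tendsto_add_atTop_nat 1))
      (Or.inr hEtop)).trans (by simp)
  simpa using ge_of_tendsto' hlim key

/-- Each survived step after the change gains at least `c`, and the total gain cannot exceed `M`.
The bound `M` must also hold above `ν`, because the stopped statistic overshoots. -/
lemma worstCaseDelay_cusumTime_le (hz : Measurable z) {φ : ℝ → ℝ≥0∞} (hφ : Measurable φ)
    {c M : ℝ≥0∞} (hc : c ≠ 0) (hc' : c ≠ ∞) (hM : ∀ y, 0 ≤ y → φ y ≤ M)
    (h : ∀ y, 0 ≤ y → y < ν → φ y + c ≤ ∫⁻ x, φ (max (y + z x) 0) ∂Q₁) :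
    worstCaseDelay Q₀ Q₁ (cusumTime z ν) ≤ M / c := by
  have hT : IsObsStoppingTime (cusumTime z ν) := isObsStoppingTime_cusumTime hz
  refine worstCaseDelay_le fun s A hA => ?_
  set P := changeLaw Q₀ Q₁ ((s + 1 : ℕ) : ℕ∞) with hP
  have hA' : MeasurableSet A := obsFiltration.le s A hA
  have hm : Measurable[obsFiltration s] (A.indicator (1 : (ℕ → ℝ) → ℝ≥0∞)) :=
    Measurable.indicator (m := obsFiltration s) (f := 1) measurable_const hA
  have key : ∀ N, s ≤ N → c * ∫⁻ ω in A,
      ∑ k ∈ Finset.Ico s N, (if (k : ℕ∞) < cusumTime z ν ω then (1 : ℝ≥0∞) else 0) ∂P ≤ M * P A := by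
    intro N hN
    have := sum_le_lintegral_mul_cusum
      (μ := fun i : ℕ => if ((i + 1 : ℕ) : ℕ∞) < ((s + 1 : ℕ) : ℕ∞) then Q₀ else Q₁) hz hT hN hm hφ
      -- For `k ≥ s` the observation `ω k` is `X_{k+1}`, already drawn from `Q₁` when the change
      -- time is `s + 1`.
      (c := c) (fun k hk ω hkω => by
        have : ¬ ((k + 1 : ℕ) : ℕ∞) < ((s + 1 : ℕ) : ℕ∞) := by
          rw [Nat.cast_lt]; omega
        simp only [this, if_false]
        exact h _ (cusum_nonneg k ω) (cusum_lt_of_lt_cusumTime hkω))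
    have h3 := (le_add_self.trans this).trans (lintegral_mono (g := fun ω => M * A.indicator 1 ω)
      fun ω => by simp only [mul_comm M]; exact mul_le_mul_right (hM _ (cusum_nonneg N ω)) _)
    rw [lintegral_const_mul _ (measurable_one.indicator hA'), lintegral_indicator_one hA'] at h3
    refine le_trans (le_of_eq ?_) h3
    rw [lintegral_finsetSum _ fun k _ => measurable_survival' hT k]
    congr 1
    refine Finset.sum_congr rfl fun k _ => ?_
    rw [← lintegral_indicator hA']
    refine lintegral_congr fun ω => ?_
    by_cases hω : ω ∈ A <;> simp [hω]
  have hsup : ∫⁻ ω in A, ((cusumTime z ν ω : ℝ≥0∞) + 1 - ((s + 1 : ℕ) : ℝ≥0∞)) ∂P =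
      ⨆ N : ℕ, ∫⁻ ω in A,
        ∑ k ∈ Finset.Ico s N, (if (k : ℕ∞) < cusumTime z ν ω then (1 : ℝ≥0∞) else 0) ∂P := by
    simp only [delay_eq]
    exact lintegral_iSup (fun N => measurable_sum_survival hT s N)
      fun M N h ω => monotone_sum_survival _ s h
  rw [hsup]
  refine iSup_le fun N => ?_
  rw [ENNReal.div_eq_inv_mul, mul_assoc, ← ENNReal.div_eq_inv_mul,
    ENNReal.le_div_iff_mul_le (Or.inl hc) (Or.inl hc'), mul_comm]
  rcases le_total s N with hN | hN
  · exact key N hN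
  · simp [Finset.Ico_eq_empty_of_le hN]

end CusumTime

/-! ### Change of measure on finitely many observations -/

section ChangeOfMeasure

variable {Q₀ Q₁ : Measure ℝ} [IsProbabilityMeasure Q₀] [IsProbabilityMeasure Q₁] {z : ℝ → ℝ}

/-- The likelihood ratio of the observations `s, …, k - 1`. -/
noncomputable def pathRatio (z : ℝ → ℝ) (s k : ℕ) (ω : ℕ → ℝ) : ℝ≥0∞ :=
  ∏ i ∈ Finset.Ico s k, ENNReal.ofReal (Real.exp (z (ω i)))

lemma measurable_pathRatio (hz : Measurable z) (s k : ℕ) :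
    Measurable[obsFiltration k] (pathRatio z s k) := by
  unfold pathRatio
  refine Finset.measurable_fun_prod _ fun i hi => ?_
  have h := measurable_eval_obsFiltration (Finset.mem_Ico.1 hi).2
  exact ((Real.measurable_exp.comp hz).ennreal_ofReal).comp h

lemma pathRatio_update (s k : ℕ) (ω : ℕ → ℝ) (x : ℝ) :
    pathRatio z s k (Function.update ω k x) = pathRatio z s k ω := by
  refine Finset.prod_congr rfl fun i hi => ?_
  rw [Function.update_of_ne (Finset.mem_Ico.1 hi).2.ne]

/-- Induction on `k`, integrating out the last observation: it contributes a factor `e^z` if it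
comes after the change and nothing otherwise. No relation between `s` and `k` is needed, since the
ratio is an empty product when `k ≤ s`. -/
lemma lintegral_changeLaw (hz : Measurable z)
    (hQ : Q₁ = Q₀.withDensity fun x => ENNReal.ofReal (Real.exp (z x))) (s k : ℕ)
    {f : (ℕ → ℝ) → ℝ≥0∞} (hf : Measurable[obsFiltration k] f) :
    ∫⁻ ω, f ω ∂changeLaw Q₀ Q₁ ((s + 1 : ℕ) : ℕ∞) =
      ∫⁻ ω, pathRatio z s k ω * f ω ∂changeLaw Q₀ Q₁ ⊤ := by
  induction k generalizing f with
  | zero =>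
    have h : ∀ ω, f ω = f 0 := fun ω => by
      rw [← apply_truncPath hf ω]; congr 1
    simp [h, pathRatio]
  | succ k ih =>
    have hf' : Measurable f := hf.mono (obsFiltration.le _) le_rfl
    have hl : Measurable fun x => ENNReal.ofReal (Real.exp (z x)) := by fun_prop
    have e1 := lintegral_update_eq
      (μ := fun i : ℕ => if ((i + 1 : ℕ) : ℕ∞) < ((s + 1 : ℕ) : ℕ∞) then Q₀ else Q₁) k hf
    have e2 := lintegral_update_eq
      (μ := fun i : ℕ => if ((i + 1 : ℕ) : ℕ∞) < ⊤ then Q₀ else Q₁) k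
      ((measurable_pathRatio hz s (k + 1)).mul hf)
    change ∫⁻ ω, f ω ∂changeLaw Q₀ Q₁ ((s + 1 : ℕ) : ℕ∞) = _ at e1
    change ∫⁻ ω, pathRatio z s (k + 1) ω * f ω ∂changeLaw Q₀ Q₁ ⊤ = _ at e2
    have e3 := ih (measurable_lintegral_update k hf
      (if ((k + 1 : ℕ) : ℕ∞) < ((s + 1 : ℕ) : ℕ∞) then Q₀ else Q₁))
    refine e1.trans (e3.trans ?_)
    rw [e2]
    refine lintegral_congr fun ω => ?_
    have hfu : Measurable fun x => f (Function.update ω k x) := hf'.comp (measurable_update ω)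
    rcases lt_or_ge k s with hks | hks
    · have h1 : ((k + 1 : ℕ) : ℕ∞) < ((s + 1 : ℕ) : ℕ∞) := by rw [Nat.cast_lt]; omega
      have h2 : Finset.Ico s (k + 1) = ∅ := Finset.Ico_eq_empty_of_le hks
      have h3 : Finset.Ico s k = ∅ := Finset.Ico_eq_empty_of_le hks.le
      have h4 : ((k + 1 : ℕ) : ℕ∞) < ⊤ := by simp
      simp only [pathRatio, h1, h2, h3, h4, if_true, Finset.prod_empty, one_mul, Pi.mul_apply]
    · have h1 : ¬ ((k + 1 : ℕ) : ℕ∞) < ((s + 1 : ℕ) : ℕ∞) := by rw [Nat.cast_lt]; omega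
      have h4 : ((k + 1 : ℕ) : ℕ∞) < ⊤ := by simp
      have h5 : ∀ x, pathRatio z s (k + 1) (Function.update ω k x) =
          pathRatio z s k ω * ENNReal.ofReal (Real.exp (z x)) := fun x => by
        rw [← pathRatio_update s k ω x]
        simp [pathRatio, Finset.prod_Ico_succ_top hks]
      simp only [h1, h4, if_true, if_false, Pi.mul_apply, h5, mul_assoc]
      rw [lintegral_const_mul _ (by fun_prop : Measurable fun x =>
        ENNReal.ofReal (Real.exp (z x)) * f (Function.update ω k x)), hQ, lintegral_withDensity_eq_lintegral_mul _ hl hfu]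
      rfl

end ChangeOfMeasure

lemma lintegral_ofReal_exp_eq_one {Q₀ Q₁ : Measure ℝ} [IsProbabilityMeasure Q₁] {z : ℝ → ℝ}
    (hQ : Q₁ = Q₀.withDensity fun x => ENNReal.ofReal (Real.exp (z x))) :
    ∫⁻ x, ENNReal.ofReal (Real.exp (z x)) ∂Q₀ = 1 := by
  rw [← setLIntegral_univ, ← withDensity_apply _ MeasurableSet.univ, ← hQ, measure_univ]

/-! ### Averaging the delay over change points -/

section LowerBound

variable {Q₀ Q₁ : Measure ℝ} [IsProbabilityMeasure Q₀] [IsProbabilityMeasure Q₁] {z : ℝ → ℝ}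
  {T : (ℕ → ℝ) → ℕ∞}

/-- The amount by which the exponential of the CUSUM statistic is raised to `1` at each time. -/
noncomputable def cusumDeficit (z : ℝ → ℝ) : ℕ → (ℕ → ℝ) → ℝ≥0∞
  | 0, _ => 1
  | k + 1, ω => ENNReal.ofReal (1 - Real.exp (cusum z (fun _ => ⊤) k ω + z (ω k)))

lemma measurable_cusumDeficit (hz : Measurable z) (k : ℕ) :
    Measurable[obsFiltration k] (cusumDeficit z k) := by
  cases k with
  | zero => exact measurable_const
  | succ k =>
    have h1 : Measurable[obsFiltration (k + 1)] (cusum z (fun _ => ⊤) k) :=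
      (measurable_cusum hz isObsStoppingTime_top k).mono (obsFiltration.mono k.le_succ) le_rfl
    have h2 : Measurable[obsFiltration (k + 1)] fun ω : ℕ → ℝ => z (ω k) :=
      hz.comp (measurable_eval_obsFiltration k.lt_succ_self)
    exact (measurable_const.sub (Real.measurable_exp.comp (h1.add h2))).ennreal_ofReal

lemma ofReal_exp_max (u : ℝ) :
    ENNReal.ofReal (Real.exp (max u 0)) =
      ENNReal.ofReal (Real.exp u) + ENNReal.ofReal (1 - Real.exp u) := by
  rcases le_total u 0 with h | h
  · rw [max_eq_right h, ← ENNReal.ofReal_add (Real.exp_pos _).le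
      (sub_nonneg.2 (Real.exp_le_one_iff.2 h))]
    simp
  · rw [max_eq_left h, ENNReal.ofReal_of_nonpos (sub_nonpos.2 (Real.one_le_exp h)), add_zero]

/-- One step multiplies `e^W` by `e^z` and then adds what is missing to reach `1`; unrolling this
recursion gives the sum. The initial value `e^0 = 1` is the deficit at time `0`. -/
lemma ofReal_exp_cusum (k : ℕ) (ω : ℕ → ℝ) :
    ENNReal.ofReal (Real.exp (cusum z (fun _ => ⊤) k ω)) =
      ∑ s ∈ Finset.range (k + 1), cusumDeficit z s ω * pathRatio z s k ω := by
  induction k with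
  | zero => simp [cusum, cusumDeficit, pathRatio]
  | succ k ih =>
    have h : ∀ s ∈ Finset.range (k + 1), cusumDeficit z s ω * pathRatio z s (k + 1) ω =
        cusumDeficit z s ω * pathRatio z s k ω * ENNReal.ofReal (Real.exp (z (ω k))) := by
      intro s hs
      rw [pathRatio, Finset.prod_Ico_succ_top (Finset.mem_range_succ_iff.1 hs), mul_assoc]
      rfl
    rw [Finset.sum_range_succ, Finset.sum_congr rfl h, ← Finset.sum_mul, ← ih]
    have hk : ((k : ℕ) : ℕ∞) < ⊤ := by simp
    rw [cusum, if_pos hk, ofReal_exp_max, Real.exp_add, ENNReal.ofReal_mul (Real.exp_pos _).le]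
    simp [cusumDeficit, pathRatio, Real.exp_add]

/-- The worst case over change points dominates any weighted average. The change point `s + 1` is
weighted by the deficit at time `s` on `{s < T}`; after a change of measure the delays add up to the
exponentials of the CUSUM statistic. -/
lemma sum_cusum_le_worstCaseDelay_mul (hz : Measurable z)
    (hQ : Q₁ = Q₀.withDensity fun x => ENNReal.ofReal (Real.exp (z x)))
    (hT : IsObsStoppingTime T) (N : ℕ) :
    ∑ k ∈ Finset.range N, ∫⁻ ω, (if (k : ℕ∞) < T ω then
        ENNReal.ofReal (Real.exp (cusum z T k ω)) else 0) ∂changeLaw Q₀ Q₁ ⊤ ≤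
      worstCaseDelay Q₀ Q₁ T * ∑ k ∈ Finset.range N,
        ∫⁻ ω, (if (k : ℕ∞) < T ω then cusumDeficit z k ω else 0) ∂changeLaw Q₀ Q₁ ⊤ := by
  set P := changeLaw Q₀ Q₁ ⊤ with hP
  set g : ℕ → ℕ → (ℕ → ℝ) → ℝ≥0∞ := fun s k ω =>
    if (k : ℕ∞) < T ω then cusumDeficit z s ω * pathRatio z s k ω else 0 with hg
  have hS : ∀ k, MeasurableSet[obsFiltration k] {ω | (k : ℕ∞) < T ω} := measurableSet_survival hT
  have hgm : ∀ s k, Measurable (g s k) := fun s k =>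
    Measurable.ite (obsFiltration.le k _ (hS k))
      (((measurable_cusumDeficit hz s).mono (obsFiltration.le s) le_rfl).mul
        ((measurable_pathRatio hz s k).mono (obsFiltration.le k) le_rfl)) measurable_const
  have hfm : ∀ s, Measurable[obsFiltration s]
      fun ω => if (s : ℕ∞) < T ω then cusumDeficit z s ω else 0 := fun s =>
    Measurable.ite (hS s) (measurable_cusumDeficit hz s) measurable_const
  have key : ∀ s, ∑ k ∈ Finset.Ico s N, ∫⁻ ω, g s k ω ∂P ≤ worstCaseDelay Q₀ Q₁ T *
      ∫⁻ ω, (if (s : ℕ∞) < T ω then cusumDeficit z s ω else 0) ∂P := by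
    intro s
    have h1 := lintegral_mul_delay_le (Q₀ := Q₀) (Q₁ := Q₁) hT s (hfm s)
    -- The weight depends on pre-change observations only, so its mean is the same as without a
    -- change.
    rw [lintegral_changeLaw hz hQ s s (hfm s)] at h1
    simp only [pathRatio, Finset.Ico_self, Finset.prod_empty, one_mul] at h1
    refine le_trans ?_ h1
    have h2 : ∀ k ∈ Finset.Ico s N, ∫⁻ ω, g s k ω ∂P = ∫⁻ ω,
        (if (k : ℕ∞) < T ω then cusumDeficit z s ω else 0)
          ∂changeLaw Q₀ Q₁ ((s + 1 : ℕ) : ℕ∞) := by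
      intro k hk
      rw [lintegral_changeLaw hz hQ s k (Measurable.ite (hS k) ((measurable_cusumDeficit hz s).mono
        (obsFiltration.mono (Finset.mem_Ico.1 hk).1) le_rfl) measurable_const)]
      refine lintegral_congr fun ω => ?_
      simp only [hg]
      split_ifs <;> simp [mul_comm]
    rw [Finset.sum_congr rfl h2, ← lintegral_finsetSum _ fun k hk => Measurable.ite
      (obsFiltration.le k _ (hS k)) ((measurable_cusumDeficit hz s).mono (obsFiltration.le s) le_rfl)
      measurable_const]
    refine lintegral_mono fun ω => ?_
    simp only [delay_eq]
    refine le_trans (le_of_eq ?_) (mul_le_mul_right (le_iSup _ N) _)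
    rw [Finset.mul_sum]
    refine Finset.sum_congr rfl fun k hk => ?_
    by_cases hkT : (k : ℕ∞) < T ω
    · have hsT : (s : ℕ∞) < T ω :=
        lt_of_le_of_lt (by exact_mod_cast (Finset.mem_Ico.1 hk).1) hkT
      simp [hkT, hsT]
    · simp [hkT]
  rw [Finset.mul_sum]
  refine le_trans (le_of_eq ?_) (Finset.sum_le_sum fun s _ => key s)
  have h3 : ∀ k ∈ Finset.range N, ∫⁻ ω, (if (k : ℕ∞) < T ω then
        ENNReal.ofReal (Real.exp (cusum z T k ω)) else 0) ∂P =
      ∑ s ∈ Finset.range (k + 1), ∫⁻ ω, g s k ω ∂P := by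
    intro k _
    rw [← lintegral_finsetSum _ fun s _ => hgm s k]
    refine lintegral_congr fun ω => ?_
    by_cases hkT : (k : ℕ∞) < T ω
    · simp only [hg, hkT, if_true]
      rw [cusum_eq_of_le hkT.le, ofReal_exp_cusum]
    · simp [hg, hkT]
  rw [Finset.sum_congr rfl h3]
  simp only [Finset.range_eq_Ico]
  -- Exchange of summation over the triangle `s ≤ k < N`.
  exact Finset.sum_sigma' _ _ _ |>.trans (Finset.sum_bij' (fun p _ => ⟨p.2, p.1⟩)
    (fun p _ => ⟨p.2, p.1⟩) (by simp; omega) (by simp; omega) (by simp) (by simp) (by simp))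
    |>.trans (Finset.sum_sigma' _ _ _).symm

/-- Since `e^z` has mean `1` under `Q₀`, the mean of `e^W` increases in each step exactly by the
deficit on `{N < T}`. The deficit is counted only on the smaller event `{N + 1 < T}`, whence an
inequality. -/
lemma sum_cusumDeficit_le (hz : Measurable z)
    (hQ : Q₁ = Q₀.withDensity fun x => ENNReal.ofReal (Real.exp (z x)))
    (hT : IsObsStoppingTime T) (N : ℕ) :
    ∑ k ∈ Finset.range (N + 1),
        ∫⁻ ω, (if (k : ℕ∞) < T ω then cusumDeficit z k ω else 0) ∂changeLaw Q₀ Q₁ ⊤ ≤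
      ∫⁻ ω, ENNReal.ofReal (Real.exp (cusum z T N ω)) ∂changeLaw Q₀ Q₁ ⊤ := by
  set P := changeLaw Q₀ Q₁ ⊤ with hP
  have hl : Measurable fun x => ENNReal.ofReal (Real.exp (z x)) := by fun_prop
  induction N with
  | zero =>
    simp only [zero_add, Finset.sum_range_one, cusum, Real.exp_zero, ENNReal.ofReal_one]
    refine lintegral_mono fun ω => ?_
    simp only [cusumDeficit]
    split_ifs <;> simp
  | succ N ih =>
    rw [Finset.sum_range_succ]
    refine (add_le_add_left ih _).trans ?_
    have hS : MeasurableSet {ω | (N : ℕ∞) < T ω} := obsFiltration.le N _ (measurableSet_survival hT N)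
    have hc := measurable_cusum' hz hT N
    have hD : Measurable (cusumDeficit z (N + 1)) :=
      (measurable_cusumDeficit hz (N + 1)).mono (obsFiltration.le _) le_rfl
    have e1 : ∫⁻ ω, ENNReal.ofReal (Real.exp (cusum z T N ω)) ∂P = ∫⁻ ω,
        (if (N : ℕ∞) < T ω then ENNReal.ofReal (Real.exp (cusum z T N ω)) *
          ENNReal.ofReal (Real.exp (z (ω N))) else ENNReal.ofReal (Real.exp (cusum z T N ω))) ∂P := by
      have h := lintegral_eval_eq (μ := fun i : ℕ => if ((i + 1 : ℕ) : ℕ∞) < ⊤ then Q₀ else Q₁) N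
        (F := fun ω x => if (N : ℕ∞) < T ω then ENNReal.ofReal (Real.exp (cusum z T N ω)) *
          ENNReal.ofReal (Real.exp (z x)) else ENNReal.ofReal (Real.exp (cusum z T N ω))) ?_ ?_
      · refine Eq.trans ?_ h.symm
        refine lintegral_congr fun ω => ?_
        have h4 : ((N + 1 : ℕ) : ℕ∞) < ⊤ := by simp
        simp only [h4, if_true]
        split_ifs
        · rw [lintegral_const_mul _ hl, lintegral_ofReal_exp_eq_one hQ, mul_one]
        · simp
      · refine Measurable.ite (measurable_fst hS) ?_ ?_
        · exact Measurable.mul (by fun_prop) (hl.comp measurable_snd)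
        · fun_prop
      · intro ω x
        have hSk : ((N : ℕ∞) < T (truncPath N ω)) = ((N : ℕ∞) < T ω) :=
          propext (Set.ext_iff.1
            ((obsFiltration_le_invariants N) _ (measurableSet_survival hT N)).2 ω)
        simp only [hSk, apply_truncPath (measurable_cusum hz hT N)]
    rw [e1, ← lintegral_add_right]
    · refine lintegral_mono fun ω => ?_
      simp only
      by_cases hN : (N : ℕ∞) < T ω
      · simp only [cusum, hN, if_true, ofReal_exp_max, Real.exp_add,
          ENNReal.ofReal_mul (Real.exp_pos _).le, cusumDeficit]
        rw [cusum_eq_of_le hN.le]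
        refine add_le_add_right ?_ _
        split_ifs <;> simp
      · have hN' : ¬ (N : ℕ∞) + 1 < T ω := fun h =>
          hN (lt_trans (by exact_mod_cast N.lt_succ_self) h)
        simp [cusum, hN, hN']
    · exact Measurable.ite (obsFiltration.le _ _ (measurableSet_survival hT (N + 1))) hD
        measurable_const

end LowerBound

/-! ### Convexity inequalities for the value functions -/

/-- The gap `e^y - y - 1` between the exponential and its tangent at `0`. -/
noncomputable def expGap (y : ℝ) : ℝ := Real.exp y - y - 1

@[fun_prop]
lemma continuous_expGap : Continuous expGap := by unfold expGap; fun_prop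

@[fun_prop]
lemma measurable_expGap : Measurable expGap := continuous_expGap.measurable

lemma expGap_nonneg (y : ℝ) : 0 ≤ expGap y := by
  have := Real.add_one_le_exp y; unfold expGap; linarith

lemma expGap_zero : expGap 0 = 0 := by simp [expGap]

lemma expGap_le_expGap {x y : ℝ} (hx : 0 ≤ x) (hxy : x ≤ y) : expGap x ≤ expGap y := by
  have h1 : Real.exp y = Real.exp x * Real.exp (y - x) := by rw [← Real.exp_add]; ring_nf
  have h2 := Real.add_one_le_exp (y - x)
  have h3 := Real.one_le_exp hx
  unfold expGap
  rw [h1]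
  nlinarith [mul_nonneg (sub_nonneg.2 h3) (sub_nonneg.2 hxy)]

lemma expGap_lt_expGap {x y : ℝ} (hx : 0 ≤ x) (hxy : x < y) : expGap x < expGap y := by
  have h1 : Real.exp y = Real.exp x * Real.exp (y - x) := by rw [← Real.exp_add]; ring_nf
  have h2 := Real.add_one_lt_exp (sub_pos.2 hxy).ne'
  have h3 := Real.one_le_exp hx
  unfold expGap
  rw [h1]
  nlinarith [mul_nonneg (sub_nonneg.2 h3) (sub_pos.2 hxy).le]

lemma expGap_le_expGap_of_nonpos {x y : ℝ} (hy : y ≤ 0) (hxy : x ≤ y) :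
    expGap y ≤ expGap x := by
  have h1 : Real.exp x = Real.exp y * Real.exp (x - y) := by rw [← Real.exp_add]; ring_nf
  have h2 := Real.add_one_le_exp (x - y)
  have h3 := Real.exp_le_one_iff.2 hy
  have h4 := Real.exp_pos y
  unfold expGap
  rw [h1]
  nlinarith [mul_nonneg (sub_nonneg.2 h3) (sub_nonneg.2 hxy)]

lemma expGap_le_sq {y : ℝ} (hy : y ≤ 0) : expGap y ≤ y ^ 2 := by
  have h1 := Real.add_one_le_exp (-y)
  have h2 : Real.exp y * Real.exp (-y) = 1 := by rw [← Real.exp_add]; simp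
  have h3 := Real.exp_pos y
  unfold expGap
  have h4 : Real.exp y * (1 - y) ≤ 1 := by nlinarith
  by_contra hcon
  push Not at hcon
  nlinarith [mul_nonneg (neg_nonneg.2 hy) (sq_nonneg y)]

lemma expGap_le_sq_mul_exp {y : ℝ} (hy : 0 ≤ y) : expGap y ≤ y ^ 2 * Real.exp y := by
  have h1 := Real.add_one_le_exp (-y)
  have h2 : Real.exp y * Real.exp (-y) = 1 := by rw [← Real.exp_add]; simp
  have h3 := Real.exp_pos y
  unfold expGap
  have h4 : Real.exp y * (1 - y) ≤ 1 := by nlinarith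
  nlinarith [mul_nonneg (by linarith : 0 ≤ y + 1) (sub_nonneg.2 h4)]

lemma expGap_max_le (u : ℝ) : expGap (max u 0) ≤ expGap u := by
  rcases le_total u 0 with h | h
  · rw [max_eq_right h, expGap_zero]; exact expGap_nonneg u
  · rw [max_eq_left h]

lemma expGap_neg_sub_le {u w : ℝ} (h : w ≤ u) : expGap (-u) - expGap (-w) ≤ u - w := by
  have := Real.exp_le_exp.2 (neg_le_neg h)
  unfold expGap
  linarith

/-- The gap `(y - 1) e^y + 1`. -/
noncomputable def tiltedGap (y : ℝ) : ℝ := Real.exp y * expGap (-y)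

@[fun_prop]
lemma measurable_tiltedGap : Measurable tiltedGap := by unfold tiltedGap; fun_prop

lemma tiltedGap_nonneg (y : ℝ) : 0 ≤ tiltedGap y :=
  mul_nonneg (Real.exp_pos y).le (expGap_nonneg _)

lemma tiltedGap_eq (y : ℝ) : tiltedGap y = Real.exp y * y - Real.exp y + 1 := by
  have h2 : Real.exp y * Real.exp (-y) = 1 := by rw [← Real.exp_add]; simp
  unfold tiltedGap expGap
  linear_combination h2

lemma tiltedGap_zero : tiltedGap 0 = 0 := by simp [tiltedGap, expGap_zero]

lemma tiltedGap_max_le (u : ℝ) : tiltedGap (max u 0) ≤ tiltedGap u := by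
  rcases le_total u 0 with h | h
  · rw [max_eq_right h, tiltedGap_zero]; exact tiltedGap_nonneg u
  · rw [max_eq_left h]

/-- The left side vanishes at `0` and its derivative is `tiltedGap`. -/
lemma sub_two_mul_exp_nonneg {δ : ℝ} (hδ : 0 ≤ δ) : 0 ≤ (δ - 2) * Real.exp δ + δ + 2 := by
  have hd : ∀ x, HasDerivAt (fun x => (x - 2) * Real.exp x + x + 2)
      (1 * Real.exp x + (x - 2) * Real.exp x + 1) x := fun x =>
    (((((hasDerivAt_id x).sub_const 2).mul (Real.hasDerivAt_exp x)).add
      (hasDerivAt_id x)).add_const 2)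
  have hm : Monotone fun x => (x - 2) * Real.exp x + x + 2 := by
    refine monotone_of_deriv_nonneg (fun x => (hd x).differentiableAt) fun x => ?_
    rw [(hd x).deriv]
    have := tiltedGap_nonneg x
    rw [tiltedGap_eq] at this
    linarith
  have := hm hδ
  simpa using this

/-- The Lagrangian inequality behind the optimality of the CUSUM threshold `ν`. -/
lemma lagrangian_le {v ν : ℝ} (hv : 0 ≤ v) (hν : 0 ≤ ν) :
    expGap (-ν) * Real.exp v + expGap v ≤ tiltedGap v + expGap ν := by
  obtain ⟨δ, rfl⟩ : ∃ δ, v = ν + δ := ⟨v - ν, by ring⟩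
  have h1 : Real.exp (-ν) * Real.exp (ν + δ) = Real.exp δ := by rw [← Real.exp_add]; ring_nf
  -- With `v = ν + δ` this is exactly the difference of the two sides. For `δ ≥ 0` the factor `e^ν`
  -- is bounded below by `1`. For `δ ≤ 0` the constraint `v ≥ 0` gives `e^ν ≥ e^{-δ}`, and `g(-δ) -
  -- g(δ) = 2 (sinh(-δ) - (-δ)) ≥ 0`.
  suffices h : 0 ≤ Real.exp ν * tiltedGap δ - expGap δ by
    rw [tiltedGap_eq] at h ⊢
    unfold expGap at h ⊢
    have h2 := Real.exp_add ν δ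
    have h3 : Real.exp (-ν) * (Real.exp ν * Real.exp δ) = Real.exp δ := by rw [← h2, h1]
    rw [h2]
    nlinarith
  rcases le_total 0 δ with hδ | hδ
  · have h2 := Real.one_le_exp hν
    have h3 := sub_two_mul_exp_nonneg hδ
    have h4 := mul_le_mul_of_nonneg_right h2 (tiltedGap_nonneg δ)
    rw [one_mul, tiltedGap_eq] at h4
    rw [tiltedGap_eq]
    unfold expGap
    linarith
  · have h2 : Real.exp (-δ) ≤ Real.exp ν := Real.exp_le_exp.2 (by linarith)
    have h4 := mul_le_mul_of_nonneg_right h2 (tiltedGap_nonneg δ)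
    have h5 := Real.self_le_sinh_iff.2 (neg_nonneg.2 hδ)
    rw [Real.sinh_eq, neg_neg] at h5
    have h6 : Real.exp (-δ) * Real.exp δ = 1 := by rw [← Real.exp_add]; simp
    rw [tiltedGap_eq] at h4 ⊢
    unfold expGap
    nlinarith

/-- With `r = e^{-v/2}` one has `v ≥ 2(1 - r)`, so the right side is at least `(1 - r)²`, while `1 -
r² ≤ 2(1 - r)`. -/
lemma sq_one_sub_exp_neg_le {v : ℝ} (hv : 0 ≤ v) :
    (1 - Real.exp (-v)) ^ 2 / 4 ≤ expGap (-v) := by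
  have h1 : Real.exp (-v) = Real.exp (-(v / 2)) ^ 2 := by rw [← Real.exp_nat_mul]; ring_nf
  have h2 := Real.add_one_le_exp (-(v / 2))
  have h3 : Real.exp (-(v / 2)) ≤ 1 := Real.exp_le_one_iff.2 (by linarith)
  have h4 := Real.exp_pos (-(v / 2))
  unfold expGap
  rw [h1]
  set q := Real.exp (-(v / 2))
  have h5 : (1 - q ^ 2) ^ 2 ≤ 4 * (1 - q) ^ 2 := by
    have : 4 * (1 - q) ^ 2 - (1 - q ^ 2) ^ 2 = (1 - q) ^ 2 * ((1 - q) * (3 + q)) := by ring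
    have h6 : 0 ≤ (1 - q) ^ 2 * ((1 - q) * (3 + q)) :=
      mul_nonneg (sq_nonneg _) (mul_nonneg (by linarith) (by linarith))
    linarith
  nlinarith

/-- The arithmetic-geometric mean inequality applied to the preceding bound, multiplied by `e^v`. -/
lemma exp_le_add_tiltedGap {v s : ℝ} (hv : 0 ≤ v) (hs : 0 < s) :
    Real.exp v ≤ 1 + s * Real.exp v + s⁻¹ * tiltedGap v := by
  have h1 : Real.exp v * Real.exp (-v) = 1 := by rw [← Real.exp_add]; simp
  have h3 : 1 - Real.exp (-v) ≤ s + s⁻¹ * expGap (-v) := by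
    have h6 := mul_le_mul_of_nonneg_left (sq_one_sub_exp_neg_le hv) (inv_pos.2 hs).le
    generalize 1 - Real.exp (-v) = u at h6 ⊢
    have h7 : u ≤ s + s⁻¹ * (u ^ 2 / 4) := by
      rw [inv_mul_eq_div, ← sub_nonneg]
      have : s + u ^ 2 / 4 / s - u = (s - u / 2) ^ 2 / s := by field_simp; ring
      rw [this]; positivity
    linarith
  have h8 := mul_le_mul_of_nonneg_left h3 (Real.exp_pos v).le
  have h9 : Real.exp v * (1 - Real.exp (-v)) = Real.exp v - 1 := by linear_combination -h1
  rw [h9] at h8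
  have h10 : Real.exp v * (s + s⁻¹ * expGap (-v)) = s * Real.exp v + s⁻¹ * tiltedGap v := by
    unfold tiltedGap; ring
  linarith

/-! ### One-step drifts of the value functions -/

/-- `z` is a log-likelihood ratio of `Q₁` with respect to `Q₀`, with finite fourth moments. -/
structure IsLogLikelihoodRatio (Q₀ Q₁ : Measure ℝ) (z : ℝ → ℝ) : Prop where
  measurable : Measurable z
  withDensity_eq : Q₁ = Q₀.withDensity fun x => ENNReal.ofReal (Real.exp (z x))
  integrable_pow₀ : Integrable (fun x => z x ^ 4) Q₀
  integrable_pow₁ : Integrable (fun x => z x ^ 4) Q₁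

lemma ofReal_integral_le_lintegral_ofReal {α : Type*} [MeasurableSpace α] {μ : Measure α}
    {f g : α → ℝ} (hf : Integrable f μ) (h : ∀ x, f x ≤ g x) :
    ENNReal.ofReal (∫ x, f x ∂μ) ≤ ∫⁻ x, ENNReal.ofReal (g x) ∂μ := by
  refine le_trans ?_ (lintegral_mono fun x => ENNReal.ofReal_le_ofReal (h x))
  refine ENNReal.ofReal_le_of_le_toReal ?_
  rw [integral_eq_lintegral_pos_part_sub_lintegral_neg_part hf]
  linarith [ENNReal.toReal_nonneg (a := ∫⁻ x, ENNReal.ofReal (-f x) ∂μ)]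

lemma lintegral_ofReal_le_ofReal_integral {α : Type*} [MeasurableSpace α] {μ : Measure α}
    {f g : α → ℝ} (hf : Integrable f μ) (h0 : ∀ x, 0 ≤ f x) (h : ∀ x, g x ≤ f x) :
    ∫⁻ x, ENNReal.ofReal (g x) ∂μ ≤ ENNReal.ofReal (∫ x, f x ∂μ) := by
  rw [ofReal_integral_eq_lintegral_ofReal hf (Eventually.of_forall h0)]
  exact lintegral_mono fun x => ENNReal.ofReal_le_ofReal (h x)

lemma integrable_of_integrable_pow_four {μ : Measure ℝ} [IsFiniteMeasure μ] {z : ℝ → ℝ}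
    (hz : Measurable z) (h : Integrable (fun x => z x ^ 4) μ) : Integrable z μ := by
  refine Integrable.mono' ((integrable_const (1 : ℝ)).add h) hz.aestronglyMeasurable
    (Eventually.of_forall fun x => ?_)
  rw [Real.norm_eq_abs, Pi.add_apply, abs_le]
  constructor <;> nlinarith [sq_nonneg (z x ^ 2 - 1 / 2), sq_nonneg (z x - 1), sq_nonneg (z x + 1),
    sq_nonneg (z x)]

/-- The pointwise loss caused by reflecting at the boundary before the change. -/
lemma expGap_reflect_ge {y w a : ℝ} (hy : 0 ≤ y) (ha : 0 < a) :
    expGap (y + w + a) - (a ^ 2)⁻¹ * w ^ 4 ≤ expGap (max (y + w) 0 + a) := by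
  have hpos : 0 ≤ (a ^ 2)⁻¹ * w ^ 4 := by positivity
  rcases le_total 0 (y + w) with h | h
  · rw [max_eq_left h]; linarith
  · rw [max_eq_right h, zero_add]
    rcases le_total 0 (y + w + a) with h2 | h2
    · linarith [expGap_le_expGap h2 (by linarith : y + w + a ≤ a)]
    -- Thanks to the shift `a`, reflection can lower the value only after a jump `w ≤ -a`, and then
    -- `w² ≤ w⁴/a²`.
    · have h3 := expGap_le_expGap_of_nonpos h2 (by linarith : w ≤ y + w + a)
      have h4 := expGap_le_sq (by linarith : w ≤ 0)
      have h5 : w ^ 2 ≤ (a ^ 2)⁻¹ * w ^ 4 := by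
        rw [inv_mul_eq_div, le_div_iff₀ (by positivity)]
        have : a ^ 2 ≤ w ^ 2 := by nlinarith
        nlinarith [mul_le_mul_of_nonneg_left this (sq_nonneg w)]
      linarith [expGap_nonneg a]

/-- The value function after the change, shifted by `a` and frozen at `ν + 2 a`. -/
noncomputable def cappedGap (ν a y : ℝ) : ℝ := expGap (-(min (y + a) (ν + 2 * a)))

lemma measurable_cappedGap (ν a : ℝ) : Measurable (cappedGap ν a) := by
  unfold cappedGap; fun_prop

/-- The pointwise loss caused by reflecting at the boundary and freezing after the change. -/
lemma cappedGap_reflect_ge {y w a ν : ℝ} (hy : 0 ≤ y) (hyν : y < ν) (ha : 0 < a) :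
    expGap (-(y + w + a)) - (a ^ 3)⁻¹ * w ^ 4 - (a ^ 2)⁻¹ * (w ^ 4 * Real.exp (-w)) ≤
      cappedGap ν a (max (y + w) 0) := by
  have hpos : 0 ≤ (a ^ 3)⁻¹ * w ^ 4 := by positivity
  have hpos' : 0 ≤ (a ^ 2)⁻¹ * (w ^ 4 * Real.exp (-w)) := by positivity
  unfold cappedGap
  rcases le_total 0 (y + w) with h | h
  · rw [max_eq_left h]
    rcases le_total (y + w + a) (ν + 2 * a) with h2 | h2
    · rw [min_eq_left h2]; linarith
    · rw [min_eq_right h2]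
      -- Below `ν` the cap at `ν + 2a` is reached only by a jump `w ≥ a`, so the loss, at most `w`,
      -- is at most `w⁴/a³`.
      have h3 := expGap_neg_sub_le h2
      have hw : a ≤ w := by linarith
      have h4 : w ≤ (a ^ 3)⁻¹ * w ^ 4 := by
        rw [inv_mul_eq_div, le_div_iff₀ (by positivity)]
        have : a ^ 3 ≤ w ^ 3 := by gcongr
        nlinarith [mul_le_mul_of_nonneg_left this (by linarith : 0 ≤ w)]
      linarith
  · rw [max_eq_right h, zero_add, min_eq_left (by linarith)]
    rcases le_total 0 (y + w + a) with h2 | h2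
    · have := expGap_le_expGap_of_nonpos (neg_nonpos.2 h2) (by linarith : -a ≤ -(y + w + a))
      linarith
    -- The loss here is of order `w² e^{-w}`. The factor `e^{-w}` is kept because it turns the
    -- `Q₁`-mean of `w⁴ e^{-w}` into the `Q₀`-mean of `w⁴`.
    · have h3 := expGap_le_expGap (neg_nonneg.2 h2) (by linarith : -(y + w + a) ≤ -w)
      have h4 := expGap_le_sq_mul_exp (by linarith : 0 ≤ -w)
      rw [neg_sq] at h4
      have h5 : w ^ 2 * Real.exp (-w) ≤ (a ^ 2)⁻¹ * (w ^ 4 * Real.exp (-w)) := by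
        rw [← mul_assoc]
        refine mul_le_mul_of_nonneg_right ?_ (Real.exp_pos _).le
        rw [inv_mul_eq_div, le_div_iff₀ (by positivity)]
        have : a ^ 2 ≤ w ^ 2 := by nlinarith
        nlinarith [mul_le_mul_of_nonneg_left this (sq_nonneg w)]
      linarith [expGap_nonneg (-a)]

lemma exp_mul_exp_neg (z f : ℝ → ℝ) :
    (fun x => Real.exp (z x) * (f x * Real.exp (-z x))) = f := by
  funext x
  have : Real.exp (z x) * Real.exp (-z x) = 1 := by rw [← Real.exp_add]; simp
  linear_combination f x * this

lemma tiltedGap_add_eq (z : ℝ → ℝ) (y : ℝ) : (fun x => tiltedGap (y + z x)) = fun x =>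
    Real.exp (z x) * (Real.exp y * (y - 1 + z x)) + 1 := by
  funext x
  rw [tiltedGap_eq, Real.exp_add]
  ring

namespace IsLogLikelihoodRatio

variable {Q₀ Q₁ : Measure ℝ} [IsProbabilityMeasure Q₀] [IsProbabilityMeasure Q₁] {z : ℝ → ℝ}
  (h : IsLogLikelihoodRatio Q₀ Q₁ z)

include h

omit [IsProbabilityMeasure Q₁] in
lemma integrable₀ : Integrable z Q₀ :=
  integrable_of_integrable_pow_four h.measurable h.integrable_pow₀

omit [IsProbabilityMeasure Q₀] in
lemma integrable₁ : Integrable z Q₁ :=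
  integrable_of_integrable_pow_four h.measurable h.integrable_pow₁

omit [IsProbabilityMeasure Q₀] [IsProbabilityMeasure Q₁] in
lemma integral_exp_mul (f : ℝ → ℝ) : ∫ x, Real.exp (z x) * f x ∂Q₀ = ∫ x, f x ∂Q₁ := by
  have hz := h.measurable
  rw [h.withDensity_eq, integral_withDensity_eq_integral_toReal_smul (by fun_prop) (by simp)]
  simp [ENNReal.toReal_ofReal (Real.exp_pos _).le]

omit [IsProbabilityMeasure Q₀] [IsProbabilityMeasure Q₁] in
lemma integrable_exp_mul_iff (f : ℝ → ℝ) :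
    Integrable (fun x => Real.exp (z x) * f x) Q₀ ↔ Integrable f Q₁ := by
  have hz := h.measurable
  rw [h.withDensity_eq, integrable_withDensity_iff_integrable_smul' (by fun_prop) (by simp)]
  simp [ENNReal.toReal_ofReal (Real.exp_pos _).le]

omit [IsProbabilityMeasure Q₀] in
lemma integrable_exp : Integrable (fun x => Real.exp (z x)) Q₀ := by
  simpa using (h.integrable_exp_mul_iff fun _ => 1).2 (integrable_const _)

omit [IsProbabilityMeasure Q₀] in
lemma integral_exp : ∫ x, Real.exp (z x) ∂Q₀ = 1 := by
  simpa using h.integral_exp_mul fun _ => 1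

omit [IsProbabilityMeasure Q₀] [IsProbabilityMeasure Q₁] in
lemma integrable_mul_exp_neg {f : ℝ → ℝ} (hf : Integrable f Q₀) :
    Integrable (fun x => f x * Real.exp (-z x)) Q₁ := by
  rw [← h.integrable_exp_mul_iff, exp_mul_exp_neg z]; exact hf

omit [IsProbabilityMeasure Q₀] [IsProbabilityMeasure Q₁] in
lemma integral_mul_exp_neg (f : ℝ → ℝ) :
    ∫ x, f x * Real.exp (-z x) ∂Q₁ = ∫ x, f x ∂Q₀ := by
  rw [← h.integral_exp_mul, exp_mul_exp_neg z]

lemma integrable_expGap_add (y : ℝ) : Integrable (fun x => expGap (y + z x)) Q₀ := by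
  unfold expGap
  simp only [Real.exp_add]
  exact ((h.integrable_exp.const_mul _).sub ((integrable_const y).add h.integrable₀)).sub
    (integrable_const 1)

/-- Without reflection the drift is constant: `e^y` is preserved in mean because `e^z` has mean `1`,
and only the linear term moves. -/
lemma integral_expGap_add (y : ℝ) :
    ∫ x, expGap (y + z x) ∂Q₀ = expGap y - ∫ x, z x ∂Q₀ := by
  have e : (fun x => expGap (y + z x)) = fun x => Real.exp y * Real.exp (z x) - z x - (y + 1) := by
    funext x
    rw [expGap, Real.exp_add]
    ring
  have h1 := h.integrable_exp.const_mul (Real.exp y)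
  have h2 : Integrable (fun x => Real.exp y * Real.exp (z x) - z x) Q₀ := h1.sub h.integrable₀
  rw [e, integral_sub h2 (integrable_const _), integral_sub h1 h.integrable₀,
    integral_const_mul, h.integral_exp, expGap]
  simp
  ring

lemma integrable_expGap_neg_add (y : ℝ) : Integrable (fun x => expGap (-(y + z x))) Q₁ := by
  have h1 := h.integrable_mul_exp_neg (integrable_const (1 : ℝ))
  simp only [one_mul] at h1
  unfold expGap
  simp only [neg_add, Real.exp_add]
  exact ((h1.const_mul _).sub ((integrable_const (-y)).add h.integrable₁.neg)).sub
    (integrable_const 1)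

lemma integral_expGap_neg_add (y : ℝ) :
    ∫ x, expGap (-(y + z x)) ∂Q₁ = expGap (-y) + ∫ x, z x ∂Q₁ := by
  have h1 := h.integrable_mul_exp_neg (integrable_const (1 : ℝ))
  have h2 := h.integral_mul_exp_neg fun _ => (1 : ℝ)
  simp only [one_mul] at h1 h2
  have e : (fun x => expGap (-(y + z x))) =
      fun x => Real.exp (-y) * Real.exp (-z x) + z x - (1 - y) := by
    funext x
    rw [expGap, neg_add, Real.exp_add]
    ring
  have h3 := h1.const_mul (Real.exp (-y))
  have h4 : Integrable (fun x => Real.exp (-y) * Real.exp (-z x) + z x) Q₁ := h3.add h.integrable₁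
  rw [e, integral_sub h4 (integrable_const _), integral_add h3 h.integrable₁,
    integral_const_mul, h2, expGap]
  simp
  ring

omit [IsProbabilityMeasure Q₀] in
lemma integrable_tiltedGap_add_aux (y : ℝ) :
    Integrable (fun x => Real.exp (z x) * (Real.exp y * (y - 1 + z x))) Q₀ :=
  (h.integrable_exp_mul_iff _).2 (((integrable_const _).add h.integrable₁).const_mul _)

lemma integrable_tiltedGap_add (y : ℝ) : Integrable (fun x => tiltedGap (y + z x)) Q₀ := by
  rw [tiltedGap_add_eq z]
  exact (h.integrable_tiltedGap_add_aux y).add (integrable_const 1)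

/-- The factor `e^z` tilts `Q₀` into `Q₁`, so the linear term drifts by the `Q₁`-mean of `z`, scaled
by `e^y`. -/
lemma integral_tiltedGap_add (y : ℝ) :
    ∫ x, tiltedGap (y + z x) ∂Q₀ = tiltedGap y + (∫ x, z x ∂Q₁) * Real.exp y := by
  rw [tiltedGap_add_eq z, integral_add (h.integrable_tiltedGap_add_aux y) (integrable_const 1),
    h.integral_exp_mul, integral_const_mul, integral_add (integrable_const _) h.integrable₁,
    tiltedGap_eq]
  simp
  ring

lemma integral_nonpos₀ : ∫ x, z x ∂Q₀ ≤ 0 := by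
  have h1 := h.integral_expGap_add 0
  have h2 : 0 ≤ ∫ x, expGap (0 + z x) ∂Q₀ := integral_nonneg fun x => expGap_nonneg _
  rw [expGap_zero] at h1
  linarith

lemma integral_nonneg₁ : 0 ≤ ∫ x, z x ∂Q₁ := by
  have h1 := h.integral_expGap_neg_add 0
  have h2 : 0 ≤ ∫ x, expGap (-(0 + z x)) ∂Q₁ := integral_nonneg fun x => expGap_nonneg _
  rw [neg_zero, expGap_zero] at h1
  linarith

lemma lintegral_expGap_max_le (y : ℝ) :
    ∫⁻ x, ENNReal.ofReal (expGap (max (y + z x) 0)) ∂Q₀ ≤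
      ENNReal.ofReal (expGap y) + ENNReal.ofReal (-∫ x, z x ∂Q₀) := by
  rw [← ENNReal.ofReal_add (expGap_nonneg y) (neg_nonneg.2 h.integral_nonpos₀), ← sub_eq_add_neg,
    ← h.integral_expGap_add]
  exact lintegral_ofReal_le_ofReal_integral (h.integrable_expGap_add y)
    (fun x => expGap_nonneg _) fun x => expGap_max_le _

lemma lintegral_tiltedGap_max_le (y : ℝ) :
    ∫⁻ x, ENNReal.ofReal (tiltedGap (max (y + z x) 0)) ∂Q₀ ≤ ENNReal.ofReal (tiltedGap y) +
      ENNReal.ofReal (∫ x, z x ∂Q₁) * ENNReal.ofReal (Real.exp y) := by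
  rw [← ENNReal.ofReal_mul h.integral_nonneg₁, ← ENNReal.ofReal_add (tiltedGap_nonneg y)
    (mul_nonneg h.integral_nonneg₁ (Real.exp_pos y).le), ← h.integral_tiltedGap_add]
  exact lintegral_ofReal_le_ofReal_integral (h.integrable_tiltedGap_add y)
    (fun x => tiltedGap_nonneg _) fun x => tiltedGap_max_le _

/-- A crude bound; it serves to show that the mean of `e^W` is finite, so that it may be cancelled.
-/
lemma lintegral_exp_max_le (y : ℝ) :
    ∫⁻ x, ENNReal.ofReal (Real.exp (max (y + z x) 0)) ∂Q₀ ≤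
      ENNReal.ofReal (Real.exp y) + 1 := by
  have h1 : ∫ x, (Real.exp y * Real.exp (z x) + 1) ∂Q₀ = Real.exp y + 1 := by
    rw [integral_add (h.integrable_exp.const_mul _) (integrable_const 1), integral_const_mul,
      h.integral_exp]
    simp
  rw [← ENNReal.ofReal_one, ← ENNReal.ofReal_add (Real.exp_pos y).le zero_le_one, ← h1]
  refine lintegral_ofReal_le_ofReal_integral
    ((h.integrable_exp.const_mul _).add (integrable_const 1)) (fun x => by positivity) fun x => ?_
  rw [← Real.exp_add]
  rcases le_total (y + z x) 0 with hu | hu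
  · rw [max_eq_right hu, Real.exp_zero]; linarith [Real.exp_pos (y + z x)]
  · rw [max_eq_left hu]; linarith

lemma le_lintegral_expGap_max {y a : ℝ} (hy : 0 ≤ y) (ha : 0 < a)
    (hc : 0 ≤ -(∫ x, z x ∂Q₀) - (a ^ 2)⁻¹ * ∫ x, z x ^ 4 ∂Q₀) :
    ENNReal.ofReal (expGap (y + a)) +
        ENNReal.ofReal (-(∫ x, z x ∂Q₀) - (a ^ 2)⁻¹ * ∫ x, z x ^ 4 ∂Q₀) ≤
      ∫⁻ x, ENNReal.ofReal (expGap (max (y + z x) 0 + a)) ∂Q₀ := by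
  rw [← ENNReal.ofReal_add (expGap_nonneg _) hc]
  have hi : Integrable (fun x => expGap (y + z x + a)) Q₀ := by
    simpa only [add_right_comm] using h.integrable_expGap_add (y + a)
  have hi' : ∫ x, expGap (y + z x + a) ∂Q₀ = expGap (y + a) - ∫ x, z x ∂Q₀ := by
    simpa only [add_right_comm] using h.integral_expGap_add (y + a)
  have := ofReal_integral_le_lintegral_ofReal
    (hi.sub (h.integrable_pow₀.const_mul (a ^ 2)⁻¹)) fun x => expGap_reflect_ge (w := z x) hy ha
  refine le_trans (le_of_eq ?_) this
  simp only [Pi.sub_apply]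
  rw [integral_sub hi (h.integrable_pow₀.const_mul _), hi', integral_const_mul]
  ring_nf

lemma le_lintegral_cappedGap_max {y a ν : ℝ} (hy : 0 ≤ y) (hyν : y < ν) (ha : 0 < a)
    (hc : 0 ≤ (∫ x, z x ∂Q₁) - (a ^ 3)⁻¹ * (∫ x, z x ^ 4 ∂Q₁) - (a ^ 2)⁻¹ * ∫ x, z x ^ 4 ∂Q₀) :
    ENNReal.ofReal (cappedGap ν a y) + ENNReal.ofReal ((∫ x, z x ∂Q₁) -
        (a ^ 3)⁻¹ * (∫ x, z x ^ 4 ∂Q₁) - (a ^ 2)⁻¹ * ∫ x, z x ^ 4 ∂Q₀) ≤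
      ∫⁻ x, ENNReal.ofReal (cappedGap ν a (max (y + z x) 0)) ∂Q₁ := by
  rw [cappedGap, min_eq_left (by linarith), ← ENNReal.ofReal_add (expGap_nonneg _) hc]
  have hi : Integrable (fun x => expGap (-(y + z x + a))) Q₁ := by
    simpa only [add_right_comm] using h.integrable_expGap_neg_add (y + a)
  have hi' : ∫ x, expGap (-(y + z x + a)) ∂Q₁ = expGap (-(y + a)) + ∫ x, z x ∂Q₁ := by
    simpa only [add_right_comm] using h.integral_expGap_neg_add (y + a)
  have hi2 := h.integrable_pow₁.const_mul (a ^ 3)⁻¹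
  have hi3 := (h.integrable_mul_exp_neg h.integrable_pow₀).const_mul (a ^ 2)⁻¹
  have := ofReal_integral_le_lintegral_ofReal ((hi.sub hi2).sub hi3)
    fun x => cappedGap_reflect_ge (w := z x) hy hyν ha
  refine le_trans (le_of_eq ?_) this
  simp only [Pi.sub_apply]
  have hi4 : Integrable (fun x => expGap (-(y + z x + a)) - (a ^ 3)⁻¹ * z x ^ 4) Q₁ := hi.sub hi2
  rw [integral_sub hi4 hi3, integral_sub hi hi2, hi', integral_const_mul,
    integral_const_mul, h.integral_mul_exp_neg]
  ring_nf

end IsLogLikelihoodRatio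

/-! ### Constraints on an arbitrary stopping time -/

lemma mul_meanTimeToFalseAlarm_le_of_forall {Q₀ Q₁ : Measure ℝ} {T : (ℕ → ℝ) → ℕ∞}
    (hT : IsObsStoppingTime T) {c C : ℝ≥0∞}
    (hN : ∀ N, c * ∑ k ∈ Finset.range N,
      ∫⁻ ω, (if (k : ℕ∞) < T ω then 1 else 0) ∂changeLaw Q₀ Q₁ ⊤ ≤ C) :
    c * meanTimeToFalseAlarm Q₀ Q₁ T ≤ C := by
  rw [meanTimeToFalseAlarm, lintegral_iSup_sum_survival hT, ENNReal.mul_iSup]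
  refine iSup_le fun N => ?_
  rw [lintegral_finsetSum _ fun k _ => measurable_survival' hT k]
  exact hN N

namespace IsLogLikelihoodRatio

variable {Q₀ Q₁ : Measure ℝ} [IsProbabilityMeasure Q₀] [IsProbabilityMeasure Q₁] {z : ℝ → ℝ}
  {T : (ℕ → ℝ) → ℕ∞} (h : IsLogLikelihoodRatio Q₀ Q₁ z)

include h

lemma lintegral_exp_cusum_ne_top (hT : IsObsStoppingTime T) (N : ℕ) :
    ∫⁻ ω, ENNReal.ofReal (Real.exp (cusum z T N ω)) ∂changeLaw Q₀ Q₁ ⊤ ≠ ∞ := by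
  have := lintegral_cusum_le_sum (μ := fun i : ℕ => if ((i + 1 : ℕ) : ℕ∞) < ⊤ then Q₀ else Q₁)
    h.measurable hT N (φ := fun y => ENNReal.ofReal (Real.exp y)) (ρ := fun _ => 1) (by fun_prop)
    (fun k y _ => by simpa using h.lintegral_exp_max_le y)
  refine ne_top_of_le_ne_top ?_ this
  refine ENNReal.add_ne_top.2 ⟨ENNReal.ofReal_ne_top, ENNReal.sum_ne_top.2 fun k _ => ?_⟩
  refine ne_top_of_le_ne_top ENNReal.one_ne_top
    ((lintegral_mono (g := fun _ => 1) fun ω => ?_).trans (by simp))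
  simp only
  split_ifs <;> simp

/-- The total of the exponential CUSUM statistic is controlled by the worst-case delay. -/
lemma sum_exp_cusum_le (hT : IsObsStoppingTime T) (N : ℕ) :
    ∑ k ∈ Finset.range N, ∫⁻ ω, (if (k : ℕ∞) < T ω then
        ENNReal.ofReal (Real.exp (cusum z T k ω)) else 0) ∂changeLaw Q₀ Q₁ ⊤ ≤
      worstCaseDelay Q₀ Q₁ T *
        ∫⁻ ω, ENNReal.ofReal (Real.exp (cusum z T N ω)) ∂changeLaw Q₀ Q₁ ⊤ := by
  refine (sum_cusum_le_worstCaseDelay_mul h.measurable h.withDensity_eq hT N).trans ?_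
  refine mul_le_mul_right (le_trans ?_ (sum_cusumDeficit_le h.measurable h.withDensity_eq hT N)) _
  exact Finset.sum_le_sum_of_subset (Finset.range_subset_range.2 N.le_succ)

lemma lintegral_tiltedGap_cusum_le (hT : IsObsStoppingTime T) (N : ℕ) :
    ∫⁻ ω, ENNReal.ofReal (tiltedGap (cusum z T N ω)) ∂changeLaw Q₀ Q₁ ⊤ ≤
      ENNReal.ofReal (∫ x, z x ∂Q₁) * (worstCaseDelay Q₀ Q₁ T *
        ∫⁻ ω, ENNReal.ofReal (Real.exp (cusum z T N ω)) ∂changeLaw Q₀ Q₁ ⊤) := by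
  have := lintegral_cusum_le_sum (μ := fun i : ℕ => if ((i + 1 : ℕ) : ℕ∞) < ⊤ then Q₀ else Q₁)
    h.measurable hT N (φ := fun y => ENNReal.ofReal (tiltedGap y))
    (ρ := fun y => ENNReal.ofReal (∫ x, z x ∂Q₁) * ENNReal.ofReal (Real.exp y)) (by fun_prop)
    (fun k y _ => by simpa using h.lintegral_tiltedGap_max_le y)
  refine this.trans ?_
  refine le_trans (le_of_eq ?_) (mul_le_mul_right (h.sum_exp_cusum_le hT N) _)
  rw [tiltedGap_zero, ENNReal.ofReal_zero, zero_add, Finset.mul_sum]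
  refine Finset.sum_congr rfl fun k _ => ?_
  have hc := measurable_cusum' h.measurable hT k
  rw [← lintegral_const_mul]
  · refine lintegral_congr fun ω => ?_
    split_ifs <;> simp
  · exact Measurable.ite (obsFiltration.le k _ (measurableSet_survival hT k)) (by fun_prop)
      measurable_const

/-- A stopping time whose worst-case delay is below that of the threshold `ν` has a mean time to
false alarm below that of the threshold `ν`. -/
lemma mul_meanTimeToFalseAlarm_le (hT : IsObsStoppingTime T) {ν a : ℝ} (hν : 0 ≤ ν) (ha : 0 < a)
    (hc : 0 ≤ -(∫ x, z x ∂Q₀) - (a ^ 2)⁻¹ * ∫ x, z x ^ 4 ∂Q₀)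
    (hd : ENNReal.ofReal (∫ x, z x ∂Q₁) * worstCaseDelay Q₀ Q₁ T +
      ENNReal.ofReal (Real.exp a - 1) ≤ ENNReal.ofReal (expGap (-ν))) :
    ENNReal.ofReal (-(∫ x, z x ∂Q₀) - (a ^ 2)⁻¹ * ∫ x, z x ^ 4 ∂Q₀) *
      meanTimeToFalseAlarm Q₀ Q₁ T ≤ ENNReal.ofReal (expGap ν) := by
  refine mul_meanTimeToFalseAlarm_le_of_forall hT fun N => ?_
  set P := changeLaw Q₀ Q₁ ⊤ with hP
  set c := ENNReal.ofReal (-(∫ x, z x ∂Q₀) - (a ^ 2)⁻¹ * ∫ x, z x ^ 4 ∂Q₀)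
  set X := ∫⁻ ω, ENNReal.ofReal (Real.exp (cusum z T N ω)) ∂P with hX
  have hXtop : X ≠ ∞ := h.lintegral_exp_cusum_ne_top hT N
  set I := ENNReal.ofReal (∫ x, z x ∂Q₁)
  set d := worstCaseDelay Q₀ Q₁ T
  set b := ENNReal.ofReal (Real.exp a - 1)
  set D := ENNReal.ofReal (expGap (-ν))
  have hm := measurable_cusum' h.measurable hT N
  have h1 : c * ∑ k ∈ Finset.range N, ∫⁻ ω, (if (k : ℕ∞) < T ω then 1 else 0) ∂P ≤
      ∫⁻ ω, ENNReal.ofReal (expGap (cusum z T N ω + a)) ∂P := by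
    have := sum_le_lintegral_mul_cusum
      (μ := fun i : ℕ => if ((i + 1 : ℕ) : ℕ∞) < ⊤ then Q₀ else Q₁)
      h.measurable hT (Nat.zero_le N) (f := fun _ => 1) measurable_const
      (φ := fun y => ENNReal.ofReal (expGap (y + a))) (by fun_prop) (c := c)
      (fun k _ ω _ => by simpa using h.le_lintegral_expGap_max (cusum_nonneg k ω) ha hc)
    refine le_trans ?_ ((le_add_self.trans this).trans (le_of_eq ?_))
    · simp [hP, changeLaw]
    · simp [hP, changeLaw]
  -- The Lagrangian inequality at the stopped statistic. Shifting the argument by `a` changes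
  -- `expGap v` by `(e^a - 1) e^v - a`, which accounts for `b * X`.
  have h2 : D * X + ∫⁻ ω, ENNReal.ofReal (expGap (cusum z T N ω + a)) ∂P ≤
      ∫⁻ ω, ENNReal.ofReal (tiltedGap (cusum z T N ω)) ∂P + ENNReal.ofReal (expGap ν) + b * X := by
    have e1 : ENNReal.ofReal (expGap ν) = ∫⁻ _, ENNReal.ofReal (expGap ν) ∂P := by simp
    rw [e1, hX, ← lintegral_const_mul _ (by fun_prop), ← lintegral_const_mul _ (by fun_prop),
      ← lintegral_add_left (by fun_prop), ← lintegral_add_left (by fun_prop),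
      ← lintegral_add_left (by fun_prop)]
    refine lintegral_mono fun ω => ?_
    have hv := cusum_nonneg (z := z) (T := T) N ω
    generalize cusum z T N ω = v at hv
    have hb : 0 ≤ Real.exp a - 1 := sub_nonneg.2 (Real.one_le_exp ha.le)
    have he := (Real.exp_pos v).le
    rw [← ENNReal.ofReal_mul (expGap_nonneg _), ← ENNReal.ofReal_mul hb,
      ← ENNReal.ofReal_add (mul_nonneg (expGap_nonneg _) he) (expGap_nonneg _),
      ← ENNReal.ofReal_add (tiltedGap_nonneg _) (expGap_nonneg _),
      ← ENNReal.ofReal_add (add_nonneg (tiltedGap_nonneg _) (expGap_nonneg _)) (mul_nonneg hb he)]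
    refine ENNReal.ofReal_le_ofReal ?_
    have h3 := lagrangian_le hv hν
    have h4 : expGap (v + a) = expGap v + (Real.exp a - 1) * Real.exp v - a := by
      unfold expGap; rw [Real.exp_add]; ring
    rw [h4]
    linarith
  have h3 := h.lintegral_tiltedGap_cusum_le hT N
  have h4 : D * X + c * ∑ k ∈ Finset.range N, ∫⁻ ω, (if (k : ℕ∞) < T ω then 1 else 0) ∂P ≤
      D * X + ENNReal.ofReal (expGap ν) := by
    calc _ ≤ D * X + ∫⁻ ω, ENNReal.ofReal (expGap (cusum z T N ω + a)) ∂P := by gcongr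
      _ ≤ _ := h2
      _ ≤ I * (d * X) + ENNReal.ofReal (expGap ν) + b * X := by gcongr
      _ = (I * d + b) * X + ENNReal.ofReal (expGap ν) := by ring
      _ ≤ _ := by gcongr
  -- The hypothesis `hd` has absorbed both terms in `X` into `D * X`, which is finite and cancels.
  exact (ENNReal.add_le_add_iff_left (ENNReal.mul_ne_top ENNReal.ofReal_ne_top hXtop)).1 h4

/-- The worst-case delay is almost the mean time to false alarm as long as the information
gathered over the delay is small. -/
lemma mul_meanTimeToFalseAlarm_le_worstCaseDelay (hT : IsObsStoppingTime T) {s : ℝ} (hs : 0 < s)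
    {κ : ℝ≥0∞} (hκ : κ + (ENNReal.ofReal s + ENNReal.ofReal s⁻¹ *
      (ENNReal.ofReal (∫ x, z x ∂Q₁) * worstCaseDelay Q₀ Q₁ T)) = 1) :
    κ * meanTimeToFalseAlarm Q₀ Q₁ T ≤ worstCaseDelay Q₀ Q₁ T := by
  refine mul_meanTimeToFalseAlarm_le_of_forall hT fun N => ?_
  set P := changeLaw Q₀ Q₁ ⊤ with hP
  set X := ∫⁻ ω, ENNReal.ofReal (Real.exp (cusum z T N ω)) ∂P with hX
  have hXtop : X ≠ ∞ := h.lintegral_exp_cusum_ne_top hT N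
  set I := ENNReal.ofReal (∫ x, z x ∂Q₁)
  set d := worstCaseDelay Q₀ Q₁ T
  set σ := ENNReal.ofReal s + ENNReal.ofReal s⁻¹ * (I * d) with hσ
  have hσtop : σ ≠ ∞ := ne_top_of_le_ne_top ENNReal.one_ne_top (hκ ▸ le_add_self)
  have hm := measurable_cusum' h.measurable hT N
  have h1 : ∑ k ∈ Finset.range N, ∫⁻ ω, (if (k : ℕ∞) < T ω then 1 else 0) ∂P ≤ d * X := by
    refine le_trans (Finset.sum_le_sum fun k _ => lintegral_mono fun ω => ?_)
      (h.sum_exp_cusum_le hT N)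
    simp only
    split_ifs
    · exact ENNReal.one_le_ofReal.2 (Real.one_le_exp (cusum_nonneg k ω))
    · exact le_rfl
  have h2 : X ≤ 1 + ENNReal.ofReal s * X +
      ENNReal.ofReal s⁻¹ * ∫⁻ ω, ENNReal.ofReal (tiltedGap (cusum z T N ω)) ∂P := by
    have e1 : (1 : ℝ≥0∞) = ∫⁻ _, 1 ∂P := by simp
    conv_rhs => rw [e1, hX]
    rw [← lintegral_const_mul _ (by fun_prop), ← lintegral_const_mul _ (by fun_prop),
      ← lintegral_add_left (by fun_prop), ← lintegral_add_left (by fun_prop)]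
    refine lintegral_mono fun ω => ?_
    have hv := cusum_nonneg (z := z) (T := T) N ω
    simp only
    generalize cusum z T N ω = v at hv
    have hs' : 0 ≤ s⁻¹ := (inv_pos.2 hs).le
    have he := (Real.exp_pos v).le
    rw [← ENNReal.ofReal_one, ← ENNReal.ofReal_mul hs.le, ← ENNReal.ofReal_mul hs',
      ← ENNReal.ofReal_add zero_le_one (mul_nonneg hs.le he),
      ← ENNReal.ofReal_add (by positivity) (mul_nonneg hs' (tiltedGap_nonneg _))]
    exact ENNReal.ofReal_le_ofReal (exp_le_add_tiltedGap hv hs)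
  have h3 : σ * X + κ * X ≤ σ * X + 1 := by
    calc σ * X + κ * X = (κ + σ) * X := by ring
      _ = X := by rw [hκ, one_mul]
      _ ≤ _ := h2
      _ ≤ 1 + ENNReal.ofReal s * X + ENNReal.ofReal s⁻¹ * (I * (d * X)) := by
        gcongr; exact h.lintegral_tiltedGap_cusum_le hT N
      _ = σ * X + 1 := by rw [hσ]; ring
  have h4 : κ * X ≤ 1 := (ENNReal.add_le_add_iff_left (ENNReal.mul_ne_top hσtop hXtop)).1 h3
  calc κ * _ ≤ κ * (d * X) := by gcongr
    _ = d * (κ * X) := by ring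
    _ ≤ d * 1 := by gcongr
    _ = d := mul_one d

end IsLogLikelihoodRatio

/-! ### Nonasymptotic bounds on the optimal delay -/

section OptimalDelay

variable {Q₀ Q₁ : Measure ℝ} [IsProbabilityMeasure Q₀] [IsProbabilityMeasure Q₁] {z : ℝ → ℝ}

omit [IsProbabilityMeasure Q₀] [IsProbabilityMeasure Q₁] in
lemma optimalDelay_le_worstCaseDelay {T : (ℕ → ℝ) → ℕ∞} {γ : ℝ} (hT : IsObsStoppingTime T)
    (hγ : ENNReal.ofReal γ ≤ meanTimeToFalseAlarm Q₀ Q₁ T) :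
    optimalDelay Q₀ Q₁ γ ≤ worstCaseDelay Q₀ Q₁ T :=
  iInf_le_of_le T (iInf_le_of_le hT (iInf_le_of_le hγ le_rfl))

lemma optimalDelay_le_ceil (γ : ℝ) : optimalDelay Q₀ Q₁ γ ≤ (⌈γ⌉₊ : ℝ≥0∞) := by
  have hT : IsObsStoppingTime fun _ => (⌈γ⌉₊ : ℕ∞) := isStoppingTime_const obsFiltration ⌈γ⌉₊
  refine (optimalDelay_le_worstCaseDelay hT ?_).trans (worstCaseDelay_le fun s A hA => ?_)
  · simp only [meanTimeToFalseAlarm, lintegral_const, measure_univ, mul_one, ENat.toENNReal_coe]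
    rw [← ENNReal.ofReal_natCast]
    exact ENNReal.ofReal_le_ofReal (Nat.le_ceil γ)
  · rw [setLIntegral_const]
    refine mul_le_mul_left ?_ _
    simp only [ENat.toENNReal_coe]
    rw [tsub_le_iff_right]
    gcongr
    push_cast
    exact le_add_self

namespace IsLogLikelihoodRatio

variable (h : IsLogLikelihoodRatio Q₀ Q₁ z)

include h

/-- The competitor is the CUSUM time with threshold `ν`. The constant `c` is the post-change
information less the losses from reflection and from the cap. -/
lemma optimalDelay_le {γ ν a c : ℝ} (hν : 0 < ν) (ha : 0 < a) (hc : 0 < c)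
    (hc' : c = (∫ x, z x ∂Q₁) - (a ^ 3)⁻¹ * (∫ x, z x ^ 4 ∂Q₁) - (a ^ 2)⁻¹ * ∫ x, z x ^ 4 ∂Q₀)
    (hI : 0 < -∫ x, z x ∂Q₀) (hγ : γ * (-∫ x, z x ∂Q₀) ≤ expGap ν) :
    optimalDelay Q₀ Q₁ γ ≤ ENNReal.ofReal (expGap (-(ν + 2 * a)) / c) := by
  have hI' : ENNReal.ofReal (-∫ x, z x ∂Q₀) ≠ 0 := (ENNReal.ofReal_pos.2 hI).ne'
  refine (optimalDelay_le_worstCaseDelay (T := cusumTime z ν)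
    (isObsStoppingTime_cusumTime h.measurable) ?_).trans ?_
  · have := le_mul_meanTimeToFalseAlarm_cusumTime (Q₀ := Q₀) (Q₁ := Q₁) h.measurable (ν := ν)
      (φ := fun y => ENNReal.ofReal (expGap y)) (by fun_prop) (by simp [expGap_zero]) hI'
      (ENNReal.ofReal_ne_top (r := expGap ν)) (fun y _ => h.lintegral_expGap_max_le y)
      (fun y hy => ENNReal.ofReal_le_ofReal (expGap_le_expGap hν.le hy))
    refine (ENNReal.mul_le_mul_iff_right hI' ENNReal.ofReal_ne_top).1 (le_trans ?_ this)
    rw [← ENNReal.ofReal_mul hI.le, mul_comm]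
    exact ENNReal.ofReal_le_ofReal hγ
  · rw [ENNReal.ofReal_div_of_pos hc]
    refine worstCaseDelay_cusumTime_le h.measurable
      (φ := fun y => ENNReal.ofReal (cappedGap ν a y)) (measurable_cappedGap ν a).ennreal_ofReal
      (ENNReal.ofReal_pos.2 hc).ne' ENNReal.ofReal_ne_top (fun y hy => ?_) fun y hy hyν => ?_
    · refine ENNReal.ofReal_le_ofReal (expGap_le_expGap_of_nonpos ?_ ?_)
      · exact neg_nonpos.2 (le_min (by linarith) (by linarith))
      · exact neg_le_neg (min_le_right _ _)
    · subst hc'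
      exact h.le_lintegral_cappedGap_max hy hyν ha hc.le

/-- A smaller delay would satisfy the hypothesis of `mul_meanTimeToFalseAlarm_le` and force the mean
time to false alarm below `γ`. -/
lemma le_optimalDelay {γ ν a c : ℝ} (hν : 0 ≤ ν) (ha : 0 < a) (hc : 0 < c)
    (hc' : c = -(∫ x, z x ∂Q₀) - (a ^ 2)⁻¹ * ∫ x, z x ^ 4 ∂Q₀)
    (hI : 0 < ∫ x, z x ∂Q₁) (hγ : expGap ν < c * γ) :
    ENNReal.ofReal ((expGap (-ν) - (Real.exp a - 1)) / ∫ x, z x ∂Q₁) ≤ optimalDelay Q₀ Q₁ γ := by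
  refine le_iInf fun T => le_iInf fun hT => le_iInf fun hm => ?_
  by_contra hlt
  push Not at hlt
  have hb : 0 ≤ Real.exp a - 1 := sub_nonneg.2 (Real.one_le_exp ha.le)
  have hpos : 0 < (expGap (-ν) - (Real.exp a - 1)) / ∫ x, z x ∂Q₁ :=
    ENNReal.ofReal_pos.1 (lt_of_le_of_lt zero_le hlt)
  have hpos' : 0 ≤ expGap (-ν) - (Real.exp a - 1) := ((div_pos_iff_of_pos_right hI).1 hpos).le
  have h1 := h.mul_meanTimeToFalseAlarm_le hT hν ha (hc' ▸ hc.le) (by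
    have h2 : ENNReal.ofReal (∫ x, z x ∂Q₁) * worstCaseDelay Q₀ Q₁ T ≤
        ENNReal.ofReal (expGap (-ν) - (Real.exp a - 1)) := by
      refine (mul_le_mul_right hlt.le _).trans (le_of_eq ?_)
      rw [← ENNReal.ofReal_mul hI.le, mul_div_cancel₀ _ hI.ne']
    refine (add_le_add_left h2 _).trans (le_of_eq ?_)
    rw [← ENNReal.ofReal_add hpos' hb, sub_add_cancel])
  rw [← hc'] at h1
  have h3 := (mul_le_mul_right hm (ENNReal.ofReal c)).trans h1
  rw [← ENNReal.ofReal_mul hc.le, ENNReal.ofReal_le_ofReal_iff (expGap_nonneg ν)] at h3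
  linarith

/-- A time violating the bound has delay at most `γ`, so the unknown delay inside the error term may
be replaced by `γ`. -/
lemma mul_le_optimalDelay {γ s : ℝ} (hγ : 0 < γ) (hs : 0 < s) :
    ENNReal.ofReal (γ * (1 - s - s⁻¹ * ((∫ x, z x ∂Q₁) * γ))) ≤ optimalDelay Q₀ Q₁ γ := by
  have hI := h.integral_nonneg₁
  set I := ∫ x, z x ∂Q₁ with hIdef
  rcases le_total (1 - s - s⁻¹ * (I * γ)) 0 with hκ | hκ
  · rw [ENNReal.ofReal_of_nonpos (mul_nonpos_of_nonneg_of_nonpos hγ.le hκ)]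
    exact zero_le
  refine le_iInf fun T => le_iInf fun hT => le_iInf fun hm => ?_
  have hs' : 0 < s⁻¹ := inv_pos.2 hs
  have hsum : 0 ≤ s⁻¹ * (I * γ) := mul_nonneg hs'.le (mul_nonneg hI hγ.le)
  by_contra hlt
  push Not at hlt
  have hd : worstCaseDelay Q₀ Q₁ T ≤ ENNReal.ofReal γ :=
    hlt.le.trans (ENNReal.ofReal_le_ofReal (by nlinarith))
  set σ := ENNReal.ofReal s + ENNReal.ofReal s⁻¹ *
    (ENNReal.ofReal I * worstCaseDelay Q₀ Q₁ T) with hσ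
  have hσ1 : σ ≤ ENNReal.ofReal (s + s⁻¹ * (I * γ)) := by
    rw [hσ, ENNReal.ofReal_add hs.le hsum, ENNReal.ofReal_mul hs'.le, ENNReal.ofReal_mul hI]
    gcongr
  have hσ2 : σ ≤ 1 := hσ1.trans (ENNReal.ofReal_le_one.2 (by linarith))
  have h1 := h.mul_meanTimeToFalseAlarm_le_worstCaseDelay hT hs (κ := 1 - σ)
    (tsub_add_cancel_of_le hσ2)
  have h2 : ENNReal.ofReal (1 - s - s⁻¹ * (I * γ)) ≤ 1 - σ := by
    refine le_trans (le_of_eq ?_) (tsub_le_tsub_left hσ1 1)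
    rw [← ENNReal.ofReal_one, ← ENNReal.ofReal_sub _ (by positivity)]
    ring_nf
  refine absurd ((mul_le_mul' h2 hm).trans h1) (not_le.2 ?_)
  rwa [← ENNReal.ofReal_mul hκ, mul_comm]

end IsLogLikelihoodRatio

end OptimalDelay

/-! ### Exponential laws: moments of the log-likelihood ratio -/

section Exponential

lemma measurable_exponentialPDF (r : ℝ) : Measurable (exponentialPDF r) :=
  (measurable_exponentialPDFReal r).ennreal_ofReal

lemma exponentialPDF_toReal_mul {r : ℝ} (hr : 0 < r) (f : ℝ → ℝ) :
    (fun x => (exponentialPDF r x).toReal • f x) =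
      (Set.Ici 0).indicator fun x => r * Real.exp (-(r * x)) * f x := by
  funext x
  rcases le_or_gt 0 x with hx | hx
  · rw [Set.indicator_of_mem (Set.mem_Ici.2 hx), exponentialPDF_of_nonneg hx,
      ENNReal.toReal_ofReal (by positivity), smul_eq_mul]
  · rw [Set.indicator_of_notMem (by simpa using hx), exponentialPDF_of_neg hx]
    simp

lemma integral_expMeasure {r : ℝ} (hr : 0 < r) (f : ℝ → ℝ) :
    ∫ x, f x ∂expMeasure r = ∫ x in Set.Ioi 0, r * Real.exp (-(r * x)) * f x := by
  have e : expMeasure r = volume.withDensity (exponentialPDF r) := rfl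
  rw [e, integral_withDensity_eq_integral_toReal_smul (measurable_exponentialPDF r)
    (Eventually.of_forall fun x => ENNReal.ofReal_lt_top), exponentialPDF_toReal_mul hr,
    integral_indicator measurableSet_Ici, integral_Ici_eq_integral_Ioi]

lemma integrable_expMeasure_iff {r : ℝ} (hr : 0 < r) (f : ℝ → ℝ) :
    Integrable f (expMeasure r) ↔
      IntegrableOn (fun x => r * Real.exp (-(r * x)) * f x) (Set.Ioi 0) := by
  have e : expMeasure r = volume.withDensity (exponentialPDF r) := rfl
  rw [e, integrable_withDensity_iff_integrable_smul' (measurable_exponentialPDF r)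
    (Eventually.of_forall fun x => ENNReal.ofReal_lt_top), exponentialPDF_toReal_mul hr,
    integrable_indicator_iff measurableSet_Ici, integrableOn_Ici_iff_integrableOn_Ioi]

lemma ae_nonneg_expMeasure (r : ℝ) : ∀ᵐ x ∂expMeasure r, 0 ≤ x := by
  have e : expMeasure r = volume.withDensity (exponentialPDF r) := rfl
  rw [e, ae_withDensity_iff (measurable_exponentialPDF r)]
  refine Eventually.of_forall fun x hx => ?_
  by_contra h
  exact hx (exponentialPDF_of_neg (not_le.1 h))

lemma exp_mul_expMeasure_eq (r s : ℝ) :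
    (fun x => r * Real.exp (-(r * x)) * Real.exp (s * x)) =
      fun x => r * Real.exp ((s - r) * x) := by
  funext x
  rw [mul_assoc, ← Real.exp_add]
  ring_nf

lemma integrable_exp_mul_expMeasure {r s : ℝ} (hr : 0 < r) (hs : s < r) :
    Integrable (fun x => Real.exp (s * x)) (expMeasure r) := by
  rw [integrable_expMeasure_iff hr, exp_mul_expMeasure_eq]
  exact (integrableOn_exp_mul_Ioi (sub_neg.2 hs) 0).const_mul r

lemma integral_exp_mul_expMeasure {r s : ℝ} (hr : 0 < r) (hs : s < r) :
    ∫ x, Real.exp (s * x) ∂expMeasure r = r / (r - s) := by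
  rw [integral_expMeasure hr, exp_mul_expMeasure_eq, integral_const_mul,
    integral_exp_mul_Ioi (sub_neg.2 hs)]
  have : s - r ≠ 0 := (sub_neg.2 hs).ne
  have : r - s ≠ 0 := (sub_pos.2 hs).ne'
  simp only [mul_zero, Real.exp_zero]
  field_simp
  ring

lemma integral_id_expMeasure {r : ℝ} (hr : 0 < r) : ∫ x, x ∂expMeasure r = 1 / r := by
  have h := Real.integral_rpow_mul_exp_neg_mul_Ioi (a := 2) two_pos hr
  have h2 : Real.Gamma 2 = 1 := Real.Gamma_two
  rw [h2, mul_one, show (2 : ℝ) - 1 = 1 by norm_num] at h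
  simp only [Real.rpow_one, Real.rpow_two] at h
  rw [integral_expMeasure hr]
  have e : (fun x => r * Real.exp (-(r * x)) * x) = fun x => r * (x * Real.exp (-(r * x))) := by
    funext x; ring
  rw [e, integral_const_mul, h]
  field_simp

/-- The log-likelihood ratio of the exponential law of rate `μ` with respect to that of
rate `lam`. -/
noncomputable def expLogRatio (lam μ x : ℝ) : ℝ := Real.log (μ / lam) + (lam - μ) * x

lemma measurable_expLogRatio (lam μ : ℝ) : Measurable (expLogRatio lam μ) := by
  unfold expLogRatio; fun_prop

lemma expMeasure_eq_withDensity {lam μ : ℝ} (hlam : 0 < lam) (hμ : 0 < μ) :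
    expMeasure μ = (expMeasure lam).withDensity
      fun x => ENNReal.ofReal (Real.exp (expLogRatio lam μ x)) := by
  have e : ∀ r, expMeasure r = volume.withDensity (exponentialPDF r) := fun _ => rfl
  rw [e, e, ← withDensity_mul _ (measurable_exponentialPDF lam)
    (measurable_expLogRatio lam μ).exp.ennreal_ofReal]
  congr 1
  funext x
  rw [Pi.mul_apply]
  rcases le_or_gt 0 x with hx | hx
  · rw [exponentialPDF_of_nonneg hx, exponentialPDF_of_nonneg hx,
      ← ENNReal.ofReal_mul (by positivity), expLogRatio, Real.exp_add,
      Real.exp_log (div_pos hμ hlam)]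
    have h1 : Real.exp (-(μ * x)) = Real.exp (-(lam * x)) * Real.exp ((lam - μ) * x) := by
      rw [← Real.exp_add]; ring_nf
    rw [h1]
    congr 1
    field_simp
  · rw [exponentialPDF_of_neg hx, exponentialPDF_of_neg hx, zero_mul]

lemma abs_log_le {ρ : ℝ} (hρ : 1 / 2 ≤ ρ) : |Real.log ρ| ≤ 2 * |1 - ρ| := by
  have h0 : 0 < ρ := by linarith
  have h1 := Real.log_le_sub_one_of_pos h0
  have h2 := Real.one_sub_inv_le_log_of_pos h0
  have h3 : -(2 * |1 - ρ|) ≤ 1 - ρ⁻¹ := by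
    have : 1 - ρ⁻¹ = -((1 - ρ) * ρ⁻¹) := by field_simp; ring
    rw [this, neg_le_neg_iff]
    have h4 : ρ⁻¹ ≤ 2 := by rw [inv_le_comm₀ h0 two_pos]; linarith
    have h5 : 0 < ρ⁻¹ := inv_pos.2 h0
    nlinarith [le_abs_self (1 - ρ), abs_nonneg (1 - ρ)]
  rw [abs_le]
  exact ⟨by linarith, by linarith [neg_abs_le (1 - ρ), abs_nonneg (1 - ρ)]⟩

lemma expLogRatio_pow_four_le {lam μ x : ℝ} (hlam : 0 < lam) (hμ : lam / 2 ≤ μ) (hx : 0 ≤ x) :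
    expLogRatio lam μ x ^ 4 ≤
      (1 - μ / lam) ^ 4 * (6144 * Real.exp (1 / 2)) * Real.exp (lam / 4 * x) := by
  have h1 := abs_log_le (ρ := μ / lam) (by rw [le_div_iff₀ hlam]; linarith)
  have h2 : |expLogRatio lam μ x| ≤ |1 - μ / lam| * (2 + lam * x) := by
    have e : (lam - μ) * x = (1 - μ / lam) * (lam * x) := by field_simp
    have hlx : 0 ≤ lam * x := by positivity
    calc |expLogRatio lam μ x| ≤ |Real.log (μ / lam)| + |(lam - μ) * x| := abs_add_le _ _
      _ = |Real.log (μ / lam)| + |1 - μ / lam| * (lam * x) := by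
        rw [e, abs_mul, abs_of_nonneg hlx]
      _ ≤ _ := by linarith
  -- From `u⁴/4! ≤ e^u` at `u = (2 + lam x)/4`, where `6144 = 4⁴ · 4!`. The rate `lam/4` stays
  -- integrable for every law of rate at least `lam/2`.
  have h3 : (2 + lam * x) ^ 4 ≤ 6144 * (Real.exp (1 / 2) * Real.exp (lam / 4 * x)) := by
    have h4 := Real.pow_div_factorial_le_exp (x := (2 + lam * x) / 4) (by positivity) 4
    rw [← Real.exp_add, show 1 / 2 + lam / 4 * x = (2 + lam * x) / 4 by ring]
    have : ((2 + lam * x) / 4) ^ 4 / (Nat.factorial 4 : ℝ) = (2 + lam * x) ^ 4 / 6144 := by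
      norm_num [Nat.factorial]; ring
    rw [this, div_le_iff₀ (by norm_num)] at h4
    linarith
  calc expLogRatio lam μ x ^ 4 = |expLogRatio lam μ x| ^ 4 := (Even.pow_abs (by decide) _).symm
    _ ≤ (|1 - μ / lam| * (2 + lam * x)) ^ 4 := by gcongr
    _ = (1 - μ / lam) ^ 4 * (2 + lam * x) ^ 4 := by rw [mul_pow, Even.pow_abs (by decide)]
    _ ≤ (1 - μ / lam) ^ 4 * (6144 * (Real.exp (1 / 2) * Real.exp (lam / 4 * x))) := by
      gcongr
    _ = _ := by ring

lemma integrable_expLogRatio_pow_four {lam μ r : ℝ} (hlam : 0 < lam) (hμ : lam / 2 ≤ μ)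
    (hr : lam / 2 ≤ r) : Integrable (fun x => expLogRatio lam μ x ^ 4) (expMeasure r) := by
  refine Integrable.mono' ((integrable_exp_mul_expMeasure (s := lam / 4) (by linarith)
    (by linarith)).const_mul ((1 - μ / lam) ^ 4 * (6144 * Real.exp (1 / 2))))
    ((measurable_expLogRatio lam μ).pow_const 4).aestronglyMeasurable ?_
  filter_upwards [ae_nonneg_expMeasure r] with x hx
  rw [Real.norm_of_nonneg (by positivity)]
  exact expLogRatio_pow_four_le hlam hμ hx

lemma integral_expLogRatio_pow_four_le {lam μ r : ℝ} (hlam : 0 < lam) (hμ : lam / 2 ≤ μ)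
    (hr : lam / 2 ≤ r) : ∫ x, expLogRatio lam μ x ^ 4 ∂expMeasure r ≤
      12288 * Real.exp (1 / 2) * (1 - μ / lam) ^ 4 := by
  have hr0 : 0 < r := by linarith
  have hs : lam / 4 < r := by linarith
  have h := integral_mono_ae (integrable_expLogRatio_pow_four hlam hμ hr)
    ((integrable_exp_mul_expMeasure hr0 hs).const_mul
      ((1 - μ / lam) ^ 4 * (6144 * Real.exp (1 / 2)))) (by
      filter_upwards [ae_nonneg_expMeasure r] with x hx
      exact expLogRatio_pow_four_le hlam hμ hx)
  rw [integral_const_mul, integral_exp_mul_expMeasure hr0 hs] at h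
  -- This factor `2` turns `6144` into `12288`.
  have h2 : r / (r - lam / 4) ≤ 2 := by rw [div_le_iff₀ (by linarith)]; linarith
  have h3 : 0 ≤ (1 - μ / lam) ^ 4 * (6144 * Real.exp (1 / 2)) := by positivity
  nlinarith

lemma isLogLikelihoodRatio_expLogRatio {lam μ : ℝ} (hlam : 0 < lam) (hμ : lam / 2 ≤ μ) :
    IsLogLikelihoodRatio (expMeasure lam) (expMeasure μ) (expLogRatio lam μ) where
  measurable := measurable_expLogRatio lam μ
  withDensity_eq := expMeasure_eq_withDensity hlam (by linarith)
  integrable_pow₀ := integrable_expLogRatio_pow_four hlam hμ (by linarith)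
  integrable_pow₁ := integrable_expLogRatio_pow_four hlam hμ hμ

/-- The gap `ρ - 1 - log ρ`. -/
noncomputable def logGap (ρ : ℝ) : ℝ := ρ - 1 - Real.log ρ

lemma logGap_pos {ρ : ℝ} (hρ : 0 < ρ) (h : ρ ≠ 1) : 0 < logGap ρ := by
  have := Real.log_lt_sub_one_of_pos hρ h
  unfold logGap; linarith

lemma integral_expLogRatio {lam μ r : ℝ} (hr : 0 < r) :
    ∫ x, expLogRatio lam μ x ∂expMeasure r = Real.log (μ / lam) + (lam - μ) / r := by
  have := isProbabilityMeasure_expMeasure hr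
  have hi : Integrable (fun x : ℝ => x) (expMeasure r) := by
    -- A nonintegrable function has integral `0` by convention, contradicting the value `1 / r`.
    by_contra h
    have h1 := integral_undef h
    rw [integral_id_expMeasure hr] at h1
    exact (one_div_pos.2 hr).ne' h1
  unfold expLogRatio
  rw [integral_add (integrable_const _) (hi.const_mul _), integral_const_mul,
    integral_id_expMeasure hr]
  simp
  ring

lemma neg_integral_expLogRatio {lam μ : ℝ} (hlam : 0 < lam) :
    -∫ x, expLogRatio lam μ x ∂expMeasure lam = logGap (μ / lam) := by
  rw [integral_expLogRatio hlam, logGap]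
  field_simp
  ring

lemma integral_expLogRatio_self {lam μ : ℝ} (hlam : 0 < lam) (hμ : 0 < μ) :
    ∫ x, expLogRatio lam μ x ∂expMeasure μ = logGap ((μ / lam)⁻¹) := by
  have := hlam.ne'
  rw [integral_expLogRatio hμ, logGap, Real.log_inv]
  field_simp
  ring

lemma tendsto_logGap_div : Tendsto (fun ρ : ℝ => logGap ρ / ((1 - ρ) ^ 2 / 2)) (𝓝[≠] 1) (𝓝 1) := by
  have hb : ∀ᶠ ρ : ℝ in 𝓝[≠] 1,
      |logGap ρ / ((1 - ρ) ^ 2 / 2) - 1| ≤ 2 * |1 - ρ| / (1 - |1 - ρ|) := by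
    have h1 : ∀ᶠ ρ : ℝ in 𝓝[≠] 1, |1 - ρ| < 1 := by
      have hc : Tendsto (fun ρ : ℝ => |1 - ρ|) (𝓝[≠] 1) (𝓝 0) := by
        have : Continuous fun ρ : ℝ => |1 - ρ| := by fun_prop
        simpa using (this.tendsto 1).mono_left nhdsWithin_le_nhds
      exact hc.eventually_lt_const one_pos
    filter_upwards [h1, self_mem_nhdsWithin] with ρ hρ hne
    have hx : 1 - ρ ≠ 0 := sub_ne_zero.2 (Ne.symm hne)
    -- Second-order Taylor expansion of `log (1 - x)` at `x = 1 - ρ`, with a remainder of order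
    -- `|x|³`.
    have h := Real.abs_log_sub_add_sum_range_le hρ 2
    simp only [Finset.sum_range_succ, Finset.sum_range_zero, zero_add, sub_sub_cancel] at h
    norm_num at h
    have e : logGap ρ / ((1 - ρ) ^ 2 / 2) - 1 =
        -((1 - ρ) + (1 - ρ) ^ 2 / 2 + Real.log ρ) / ((1 - ρ) ^ 2 / 2) := by
      unfold logGap; field_simp; ring
    rw [e, abs_div, abs_neg, abs_of_pos (by positivity : 0 < (1 - ρ) ^ 2 / 2),
      div_le_iff₀ (by positivity)]
    refine h.trans (le_of_eq ?_)
    have h2 : (1 - ρ) ^ 2 = |1 - ρ| ^ 2 := (sq_abs _).symm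
    rw [h2]
    ring
  rw [tendsto_iff_norm_sub_tendsto_zero]
  refine squeeze_zero' (Eventually.of_forall fun _ => norm_nonneg _) hb ?_
  have hc : ContinuousAt (fun ρ : ℝ => 2 * |1 - ρ| / (1 - |1 - ρ|)) 1 := by
    refine ContinuousAt.div (by fun_prop) (by fun_prop) (by simp)
  have := hc.tendsto.mono_left (nhdsWithin_le_nhds (s := {1}ᶜ))
  simpa using this

end Exponential

/-! ### The Lambert branch in terms of the threshold -/

section Lambert

lemma exists_expGap_eq {Y : ℝ} (hY : 0 < Y) : ∃ ν, 0 < ν ∧ expGap ν = Y := by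
  have hb : Y ≤ expGap (Y + 2) := by
    have := Real.quadratic_le_exp_of_nonneg (x := Y + 2) (by linarith)
    unfold expGap; nlinarith
  obtain ⟨ν, hν, h⟩ := intermediate_value_Icc (by linarith : (0 : ℝ) ≤ Y + 2)
    continuous_expGap.continuousOn ⟨by rw [expGap_zero]; exact hY.le, hb⟩
  refine ⟨ν, lt_of_le_of_ne hν.1 fun h0 => ?_, h⟩
  rw [← h0, expGap_zero] at h
  exact hY.ne h

lemma expGap_injOn {x y : ℝ} (hx : 0 ≤ x) (hy : 0 ≤ y) (h : expGap x = expGap y) : x = y := by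
  rcases lt_trichotomy x y with hlt | heq | hlt
  · exact absurd h (expGap_lt_expGap hx hlt).ne
  · exact heq
  · exact absurd h (expGap_lt_expGap hy hlt).ne'

/-- With `w = -e^v` and `v ≥ 0`, the equation for `w` becomes `expGap v = expGap ν`, and `expGap` is
injective on `[0, ∞)`. -/
lemma lambertWNegOne_expGap {ν : ℝ} (hν : 0 ≤ ν) :
    lambertWNegOne (-Real.exp (-1 - expGap ν)) = -Real.exp ν := by
  have hset : {w : ℝ | w ≤ -1 ∧ w * Real.exp w = -Real.exp (-1 - expGap ν)} =
      {-Real.exp ν} := by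
    ext w
    simp only [Set.mem_ofPred_eq, Set.mem_singleton_iff]
    constructor
    · rintro ⟨hw, h⟩
      have hw0 : 0 < -w := by linarith
      have hv : 0 ≤ Real.log (-w) := Real.log_nonneg (by linarith)
      have hexp : Real.exp (Real.log (-w)) = -w := Real.exp_log hw0
      have h1 : Real.exp (Real.log (-w) + w) = Real.exp (-1 - expGap ν) := by
        rw [Real.exp_add, hexp]; linarith
      have h2 := Real.exp_injective h1
      have h3 : Real.log (-w) = ν := expGap_injOn hv hν (by
        rw [expGap, hexp]; linarith)
      rw [← h3, hexp, neg_neg]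
    · rintro rfl
      refine ⟨neg_le_neg (Real.one_le_exp hν), ?_⟩
      rw [neg_mul, ← Real.exp_add, expGap]
      ring_nf
  rw [lambertWNegOne, hset, csInf_singleton]

lemma G_expGap {ν : ℝ} (hν : 0 ≤ ν) : G (expGap ν) = expGap (-ν) := by
  rw [G, lambertWNegOne_expGap hν]
  have : 1 + expGap ν + -Real.exp ν = -ν := by unfold expGap; ring
  rw [this]
  unfold expGap
  ring

end Lambert

/-! ### Limits extracted from the two-sided bounds -/

section Asymptotic

variable {N q : ℝ → ℝ}

/-- The optimal delay when the information gathered over `γ` observations is unbounded. -/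
lemma tendsto_mul_div_log (hX : Tendsto (fun γ => γ * q γ) atTop atTop)
    (hU : ∀ a, 0 < a → ∀ θ, 1 < θ → ∀ᶠ γ in atTop, ∀ ν, 0 < ν → θ * (γ * q γ) ≤ expGap ν →
      N γ * q γ ≤ θ * expGap (-(ν + 2 * a)))
    (hL : ∀ a, 0 < a → ∀ θ, 0 < θ → θ < 1 → ∀ᶠ γ in atTop, ∀ ν, 0 ≤ ν →
      expGap ν < θ * (γ * q γ) → θ * (expGap (-ν) - (Real.exp a - 1)) ≤ N γ * q γ) :
    Tendsto (fun γ => N γ * q γ / Real.log (γ * q γ)) atTop (𝓝 1) := by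
  have hΛ : Tendsto (fun γ => Real.log (γ * q γ)) atTop atTop := Real.tendsto_log_atTop.comp hX
  have hinv : Tendsto (fun γ => 4 / Real.log (γ * q γ)) atTop (𝓝 0) := hΛ.const_div_atTop 4
  refine tendsto_order.2 ⟨fun b hb => ?_, fun b hb => ?_⟩
  · obtain ⟨θ, h1, h2⟩ : ∃ θ : ℝ, max b (1 / 2) < θ ∧ θ < 1 :=
      exists_between (max_lt hb (by norm_num))
    have hθb := (le_max_left _ _).trans_lt h1
    have hθ2 := (le_max_right _ _).trans_lt h1
    have hlim : Tendsto (fun γ => θ * (1 - 4 / Real.log (γ * q γ))) atTop (𝓝 (θ * (1 - 0))) :=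
      (tendsto_const_nhds.sub hinv).const_mul θ
    rw [sub_zero, mul_one] at hlim
    filter_upwards [hL 1 one_pos θ (by linarith) h2, hlim.eventually_const_lt hθb,
      hΛ.eventually_ge_atTop 1, hX.eventually_ge_atTop 1] with γ hγ hγ2 hγ3 hγ4
    set Λ := Real.log (γ * q γ) with hΛdef
    have hexp : Real.exp Λ = γ * q γ := Real.exp_log (by linarith)
    have he1 : Real.exp 1 < 3 := by linarith [Real.exp_one_lt_d9]
    have he2 : 2 < Real.exp 1 := by linarith [Real.exp_one_gt_d9]
    -- The threshold `Λ - 1` gives `expGap ν < e^Λ/2`, which is admissible because `θ > 1/2`.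
    have h4 := hγ (Λ - 1) (by linarith) (by
      have h5 : Real.exp (Λ - 1) * 2 ≤ γ * q γ := by
        rw [← hexp, ← sub_add_cancel Λ 1, Real.exp_add, sub_add_cancel]
        exact mul_le_mul_of_nonneg_left he2.le (Real.exp_pos _).le
      unfold expGap
      nlinarith)
    have h6 : θ * (Λ - 4) ≤ N γ * q γ := by
      refine le_trans (mul_le_mul_of_nonneg_left ?_ (by linarith)) h4
      unfold expGap
      linarith [Real.exp_pos (-(Λ - 1))]
    refine hγ2.trans_le ?_
    rw [le_div_iff₀ (by linarith)]
    refine le_trans (le_of_eq ?_) h6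
    field_simp
  · obtain ⟨θ, h1, h2⟩ : ∃ θ : ℝ, 1 < θ ∧ θ < min b 2 :=
      exists_between (lt_min hb (by norm_num))
    have hθb := h2.trans_le (min_le_left _ _)
    have hθ2 := h2.trans_le (min_le_right _ _)
    have hlim : Tendsto (fun γ => θ * (1 + 4 / Real.log (γ * q γ))) atTop (𝓝 (θ * (1 + 0))) :=
      (tendsto_const_nhds.add hinv).const_mul θ
    rw [add_zero, mul_one] at hlim
    filter_upwards [hU 1 one_pos θ h1, hlim.eventually_lt_const hθb,
      hΛ.eventually_ge_atTop 1, hX.eventually_ge_atTop 1] with γ hγ hγ2 hγ3 hγ4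
    set Λ := Real.log (γ * q γ) with hΛdef
    have hexp : Real.exp Λ = γ * q γ := Real.exp_log (by linarith)
    have hle : Λ + 1 ≤ γ * q γ := hexp ▸ Real.add_one_le_exp Λ
    -- Since `e² ≥ 5`, the threshold `Λ + 2` leaves room for the linear term of `expGap` and for `θ
    -- < 2`.
    have h4 := hγ (Λ + 2) (by linarith) (by
      have h5 : (5 : ℝ) ≤ Real.exp 2 := by
        have := Real.quadratic_le_exp_of_nonneg (x := (2 : ℝ)) (by norm_num)
        linarith
      have h6 : γ * q γ * 5 ≤ Real.exp (Λ + 2) := by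
        rw [Real.exp_add, hexp]
        exact mul_le_mul_of_nonneg_left h5 (by linarith)
      unfold expGap
      nlinarith)
    have h6 : N γ * q γ ≤ θ * (Λ + 4) := by
      refine h4.trans (mul_le_mul_of_nonneg_left ?_ (by linarith))
      unfold expGap
      linarith [Real.exp_le_one_iff.2 (by linarith : -(Λ + 2 + 2 * 1) ≤ 0)]
    refine lt_of_le_of_lt ?_ hγ2
    rw [div_le_iff₀ (by linarith)]
    refine h6.trans (le_of_eq ?_)
    field_simp

/-- The optimal delay when the information gathered over `γ` observations converges. -/
lemma tendsto_mul_of_tendsto {ν₀ : ℝ} (hν₀ : 0 < ν₀)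
    (hX : Tendsto (fun γ => γ * q γ) atTop (𝓝 (expGap ν₀)))
    (hU : ∀ a, 0 < a → ∀ θ, 1 < θ → ∀ᶠ γ in atTop, ∀ ν, 0 < ν → θ * (γ * q γ) ≤ expGap ν →
      N γ * q γ ≤ θ * expGap (-(ν + 2 * a)))
    (hL : ∀ a, 0 < a → ∀ θ, 0 < θ → θ < 1 → ∀ᶠ γ in atTop, ∀ ν, 0 ≤ ν →
      expGap ν < θ * (γ * q γ) → θ * (expGap (-ν) - (Real.exp a - 1)) ≤ N γ * q γ) :
    Tendsto (fun γ => N γ * q γ) atTop (𝓝 (expGap (-ν₀))) := by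
  have hmul : ∀ c : ℝ, Tendsto (fun θ : ℝ => θ * c) (𝓝 1) (𝓝 c) := fun c => by
    have : Continuous fun θ : ℝ => θ * c := by fun_prop
    simpa using this.tendsto 1
  refine tendsto_order.2 ⟨fun b hb => ?_, fun b hb => ?_⟩
  · have hc : Tendsto (fun a => expGap (-(ν₀ - a)) - (Real.exp a - 1)) (𝓝[>] 0)
        (𝓝 (expGap (-ν₀))) := by
      have : Continuous fun a => expGap (-(ν₀ - a)) - (Real.exp a - 1) := by fun_prop
      simpa using (this.tendsto 0).mono_left nhdsWithin_le_nhds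
    have hsmall : ∀ᶠ a : ℝ in 𝓝[>] 0, a < ν₀ := nhdsWithin_le_nhds (eventually_lt_nhds hν₀)
    have hpos : ∀ᶠ a : ℝ in 𝓝[>] 0, 0 < a := self_mem_nhdsWithin
    -- First `a` is taken small so that the threshold `ν₀ - a` nearly attains the limit; only then
    -- is `θ` chosen close to `1`, using the strict gap between `ν₀ - a` and `ν₀`.
    obtain ⟨a, ha1, ha2, ha3⟩ := ((hc.eventually_const_lt hb).and (hsmall.and hpos)).exists
    have hlt : expGap (ν₀ - a) < expGap ν₀ := expGap_lt_expGap (by linarith) (by linarith)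
    have hθ1 : ∀ᶠ θ : ℝ in 𝓝[<] 1, θ < 1 := self_mem_nhdsWithin
    obtain ⟨θ, ⟨⟨h1, h2⟩, h3⟩, h4⟩ := (((((hmul _).eventually_const_lt ha1).and
      ((hmul _).eventually_const_lt hlt)).and
        (eventually_gt_nhds zero_lt_one)).filter_mono nhdsWithin_le_nhds |>.and hθ1).exists
    filter_upwards [hL a ha3 θ h3 h4, (hX.const_mul θ).eventually_const_lt h2] with γ hγ hγ2
    exact h1.trans_le (hγ (ν₀ - a) (by linarith) hγ2)
  · have hc : Tendsto (fun a => expGap (-(ν₀ + a + 2 * a))) (𝓝[>] 0) (𝓝 (expGap (-ν₀))) := by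
      have : Continuous fun a => expGap (-(ν₀ + a + 2 * a)) := by fun_prop
      simpa using (this.tendsto 0).mono_left nhdsWithin_le_nhds
    have hpos : ∀ᶠ a : ℝ in 𝓝[>] 0, 0 < a := self_mem_nhdsWithin
    obtain ⟨a, ha1, ha3⟩ := ((hc.eventually_lt_const hb).and hpos).exists
    have hlt : expGap ν₀ < expGap (ν₀ + a) := expGap_lt_expGap hν₀.le (by linarith)
    have hθ1 : ∀ᶠ θ : ℝ in 𝓝[>] 1, 1 < θ := self_mem_nhdsWithin
    obtain ⟨θ, ⟨h1, h2⟩, h4⟩ := ((((hmul _).eventually_lt_const ha1).and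
      ((hmul _).eventually_lt_const hlt)).filter_mono nhdsWithin_le_nhds |>.and hθ1).exists
    filter_upwards [hU a ha3 θ h4, (hX.const_mul θ).eventually_lt_const h2] with γ hγ hγ2
    exact (hγ (ν₀ + a) (by linarith) hγ2.le).trans_lt h1

/-- The optimal delay when the information `B` per observation gathered over `γ` observations
vanishes. -/
lemma tendsto_div_of_tendsto_zero {B : ℝ → ℝ} (hB : ∀ᶠ γ in atTop, 0 < B γ)
    (hX : Tendsto (fun γ => γ * B γ) atTop (𝓝 0)) (hU : ∀ᶠ γ in atTop, N γ ≤ γ + 1)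
    (hL : ∀ᶠ γ in atTop, ∀ s, 0 < s → γ * (1 - s - s⁻¹ * (B γ * γ)) ≤ N γ) :
    Tendsto (fun γ => N γ / γ) atTop (𝓝 1) := by
  have h1 : Tendsto (fun γ => 1 - 2 * √(γ * B γ)) atTop (𝓝 1) := by
    have := (Real.continuous_sqrt.tendsto 0).comp hX
    simpa using (this.const_mul 2).const_sub 1
  have h2 : Tendsto (fun γ : ℝ => 1 + 1 / γ) atTop (𝓝 1) := by
    simpa using (tendsto_const_nhds (x := (1 : ℝ))).add (tendsto_id.const_div_atTop (1 : ℝ))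
  refine tendsto_of_tendsto_of_tendsto_of_le_of_le' h1 h2 ?_ ?_
  · filter_upwards [hB, hL, eventually_gt_atTop 0] with γ hBγ hγ hγ0
    have hpos : 0 < γ * B γ := mul_pos hγ0 hBγ
    have hs := Real.sqrt_pos.2 hpos
    have hsq := Real.mul_self_sqrt hpos.le
    -- The choice `s = √(γ B)` balances the two error terms, each of which becomes `√(γ B)`.
    have h3 := hγ _ hs
    have h4 : (√(γ * B γ))⁻¹ * (B γ * γ) = √(γ * B γ) := by
      rw [mul_comm (B γ), inv_mul_eq_iff_eq_mul₀ hs.ne', hsq]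
    rw [h4] at h3
    rw [le_div_iff₀ hγ0]
    linarith
  · filter_upwards [hU, eventually_gt_atTop 0] with γ hγ hγ0
    rw [div_le_iff₀ hγ0, add_mul, one_div_mul_cancel hγ0.ne', one_mul]
    exact hγ

end Asymptotic

/-! ### The bounds in terms of the squared rate difference -/

section ExponentialDelay

variable {lam μ γ ν a θ : ℝ}

lemma optimalDelay_expMeasure_ne_top (hlam : 0 < lam) (hμ : 0 < μ) :
    optimalDelay (expMeasure lam) (expMeasure μ) γ ≠ ∞ := by
  have := isProbabilityMeasure_expMeasure hlam
  have := isProbabilityMeasure_expMeasure hμ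
  exact ne_top_of_le_ne_top (ENNReal.natCast_ne_top _) (optimalDelay_le_ceil γ)

lemma optimalDelay_expMeasure_le_add_one (hlam : 0 < lam) (hμ : 0 < μ) (hγ : 0 ≤ γ) :
    (optimalDelay (expMeasure lam) (expMeasure μ) γ).toReal ≤ γ + 1 := by
  have := isProbabilityMeasure_expMeasure hlam
  have := isProbabilityMeasure_expMeasure hμ
  have h := ENNReal.toReal_mono (ENNReal.natCast_ne_top _)
    (optimalDelay_le_ceil (Q₀ := expMeasure lam) (Q₁ := expMeasure μ) γ)
  rw [ENNReal.toReal_natCast] at h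
  exact h.trans (Nat.ceil_lt_add_one hγ).le

/-- Both informations and the fourth-moment losses are expressed through `(1 - μ/lam)²/2`; the
factor `θ` absorbs their discrepancies for every `ν` simultaneously. -/
lemma optimalDelay_expMeasure_mul_le (hlam : 0 < lam) (hμ : lam / 2 ≤ μ) (hne : μ ≠ lam)
    (ha : 0 < a) (hν : 0 < ν) (hγ : 0 ≤ γ) (hθ : 0 < θ)
    (hA : logGap (μ / lam) ≤ θ * ((1 - μ / lam) ^ 2 / 2))
    (hC : (1 - μ / lam) ^ 2 / 2 ≤ θ * (logGap (μ / lam)⁻¹ -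
      ((a ^ 3)⁻¹ + (a ^ 2)⁻¹) * (12288 * Real.exp (1 / 2)) * (1 - μ / lam) ^ 4))
    (h : θ * (γ * ((1 - μ / lam) ^ 2 / 2)) ≤ expGap ν) :
    (optimalDelay (expMeasure lam) (expMeasure μ) γ).toReal * ((1 - μ / lam) ^ 2 / 2) ≤
      θ * expGap (-(ν + 2 * a)) := by
  have hμ0 : 0 < μ := by linarith
  have := isProbabilityMeasure_expMeasure hlam
  have := isProbabilityMeasure_expMeasure hμ0
  have hL := isLogLikelihoodRatio_expLogRatio hlam hμ
  have hρ : 1 - μ / lam ≠ 0 := by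
    rw [sub_ne_zero, ne_comm, ne_eq, div_eq_one_iff_eq hlam.ne']; exact hne
  have hq : 0 < (1 - μ / lam) ^ 2 / 2 := by positivity
  obtain ⟨c, hc⟩ : ∃ c, c = (∫ x, expLogRatio lam μ x ∂expMeasure μ) -
      (a ^ 3)⁻¹ * (∫ x, expLogRatio lam μ x ^ 4 ∂expMeasure μ) -
      (a ^ 2)⁻¹ * ∫ x, expLogRatio lam μ x ^ 4 ∂expMeasure lam := ⟨_, rfl⟩
  have hqc : (1 - μ / lam) ^ 2 / 2 ≤ θ * c := by
    refine hC.trans (mul_le_mul_of_nonneg_left ?_ hθ.le)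
    rw [hc, integral_expLogRatio_self hlam hμ0]
    have h1 := mul_le_mul_of_nonneg_left (integral_expLogRatio_pow_four_le hlam hμ hμ)
      (by positivity : 0 ≤ (a ^ 3)⁻¹)
    have h2 := mul_le_mul_of_nonneg_left
      (integral_expLogRatio_pow_four_le hlam hμ (by linarith : lam / 2 ≤ lam))
      (by positivity : 0 ≤ (a ^ 2)⁻¹)
    linarith
  have hc0 : 0 < c := pos_of_mul_pos_right (hq.trans_le hqc) hθ.le
  have hd := hL.optimalDelay_le (γ := γ) hν ha hc0 hc
    (by rw [neg_integral_expLogRatio hlam]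
        exact logGap_pos (div_pos hμ0 hlam) (by rwa [ne_eq, div_eq_one_iff_eq hlam.ne']))
    (by rw [neg_integral_expLogRatio hlam]
        refine le_trans ?_ h
        rw [mul_left_comm]
        exact mul_le_mul_of_nonneg_left hA hγ)
  have hg := expGap_nonneg (-(ν + 2 * a))
  have hN := ENNReal.toReal_le_of_le_ofReal (div_nonneg hg hc0.le) hd
  rw [le_div_iff₀ hc0] at hN
  calc _ ≤ (optimalDelay (expMeasure lam) (expMeasure μ) γ).toReal * (θ * c) :=
        mul_le_mul_of_nonneg_left hqc ENNReal.toReal_nonneg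
    _ = θ * ((optimalDelay (expMeasure lam) (expMeasure μ) γ).toReal * c) := by ring
    _ ≤ _ := mul_le_mul_of_nonneg_left hN hθ.le

lemma le_optimalDelay_expMeasure_mul (hlam : 0 < lam) (hμ : lam / 2 ≤ μ) (hne : μ ≠ lam)
    (ha : 0 < a) (hν : 0 ≤ ν) (hγ : 0 < γ) (hθ : 0 < θ)
    (hB : θ * logGap (μ / lam)⁻¹ ≤ (1 - μ / lam) ^ 2 / 2)
    (hC : θ * ((1 - μ / lam) ^ 2 / 2) ≤ logGap (μ / lam) -
      (a ^ 2)⁻¹ * (12288 * Real.exp (1 / 2)) * (1 - μ / lam) ^ 4)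
    (h : expGap ν < θ * (γ * ((1 - μ / lam) ^ 2 / 2))) :
    θ * (expGap (-ν) - (Real.exp a - 1)) ≤
      (optimalDelay (expMeasure lam) (expMeasure μ) γ).toReal * ((1 - μ / lam) ^ 2 / 2) := by
  have hμ0 : 0 < μ := by linarith
  have := isProbabilityMeasure_expMeasure hlam
  have := isProbabilityMeasure_expMeasure hμ0
  have hL := isLogLikelihoodRatio_expLogRatio hlam hμ
  have hρ : 1 - μ / lam ≠ 0 := by
    rw [sub_ne_zero, ne_comm, ne_eq, div_eq_one_iff_eq hlam.ne']; exact hne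
  have hq : 0 < (1 - μ / lam) ^ 2 / 2 := by positivity
  obtain ⟨c, hc⟩ : ∃ c, c = -(∫ x, expLogRatio lam μ x ∂expMeasure lam) -
      (a ^ 2)⁻¹ * ∫ x, expLogRatio lam μ x ^ 4 ∂expMeasure lam := ⟨_, rfl⟩
  have hqc : θ * ((1 - μ / lam) ^ 2 / 2) ≤ c := by
    refine hC.trans ?_
    rw [hc, neg_integral_expLogRatio hlam]
    have h2 := mul_le_mul_of_nonneg_left
      (integral_expLogRatio_pow_four_le hlam hμ (by linarith : lam / 2 ≤ lam))
      (by positivity : 0 ≤ (a ^ 2)⁻¹)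
    linarith
  have hc0 : 0 < c := (mul_pos hθ hq).trans_le hqc
  have hI : 0 < logGap (μ / lam)⁻¹ := by
    refine logGap_pos (inv_pos.2 (div_pos hμ0 hlam)) ?_
    rwa [ne_eq, inv_eq_one, div_eq_one_iff_eq hlam.ne']
  have hd := hL.le_optimalDelay (γ := γ) hν ha hc0 hc
    (by rwa [integral_expLogRatio_self hlam hμ0])
    (h.trans_le (by
      calc θ * (γ * ((1 - μ / lam) ^ 2 / 2)) = θ * ((1 - μ / lam) ^ 2 / 2) * γ := by ring
        _ ≤ c * γ := mul_le_mul_of_nonneg_right hqc hγ.le))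
  rw [integral_expLogRatio_self hlam hμ0] at hd
  have hN := (ENNReal.ofReal_le_iff_le_toReal (optimalDelay_expMeasure_ne_top hlam hμ0)).1 hd
  rw [div_le_iff₀ hI] at hN
  calc _ ≤ θ * ((optimalDelay (expMeasure lam) (expMeasure μ) γ).toReal * logGap (μ / lam)⁻¹) :=
        mul_le_mul_of_nonneg_left hN hθ.le
    _ = (optimalDelay (expMeasure lam) (expMeasure μ) γ).toReal * (θ * logGap (μ / lam)⁻¹) := by
        ring
    _ ≤ _ := mul_le_mul_of_nonneg_left hB ENNReal.toReal_nonneg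

lemma mul_le_optimalDelay_expMeasure {s : ℝ} (hlam : 0 < lam) (hμ : lam / 2 ≤ μ) (hγ : 0 < γ)
    (hs : 0 < s) : γ * (1 - s - s⁻¹ * (logGap (μ / lam)⁻¹ * γ)) ≤
      (optimalDelay (expMeasure lam) (expMeasure μ) γ).toReal := by
  have hμ0 : 0 < μ := by linarith
  have := isProbabilityMeasure_expMeasure hlam
  have := isProbabilityMeasure_expMeasure hμ0
  have hd := (isLogLikelihoodRatio_expLogRatio hlam hμ).mul_le_optimalDelay hγ hs
  rw [integral_expLogRatio_self hlam hμ0] at hd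
  exact (ENNReal.ofReal_le_iff_le_toReal (optimalDelay_expMeasure_ne_top hlam hμ0)).1 hd

lemma tendsto_const_mul_pow_four_div (D : ℝ) :
    Tendsto (fun ρ : ℝ => D * (1 - ρ) ^ 4 / ((1 - ρ) ^ 2 / 2)) (𝓝[≠] 1) (𝓝 0) := by
  have hc : Continuous fun ρ : ℝ => 2 * D * (1 - ρ) ^ 2 := by fun_prop
  have h : Tendsto (fun ρ : ℝ => 2 * D * (1 - ρ) ^ 2) (𝓝[≠] 1) (𝓝 0) := by
    simpa using (hc.tendsto 1).mono_left nhdsWithin_le_nhds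
  refine h.congr' ?_
  filter_upwards [self_mem_nhdsWithin] with ρ hρ
  have : 1 - ρ ≠ 0 := sub_ne_zero.2 (Ne.symm hρ)
  field_simp

lemma tendsto_logGap_sub_div (D : ℝ) :
    Tendsto (fun ρ : ℝ => (logGap ρ - D * (1 - ρ) ^ 4) / ((1 - ρ) ^ 2 / 2)) (𝓝[≠] 1) (𝓝 1) := by
  simpa [sub_div] using tendsto_logGap_div.sub (tendsto_const_mul_pow_four_div D)

/-- The substitution `ρ ↦ ρ⁻¹` preserves the punctured neighbourhood of `1`, and `(1 - ρ⁻¹)² = (1 -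
ρ)² ρ⁻²`. -/
lemma tendsto_logGap_inv_sub_div (D : ℝ) :
    Tendsto (fun ρ : ℝ => (logGap ρ⁻¹ - D * (1 - ρ) ^ 4) / ((1 - ρ) ^ 2 / 2)) (𝓝[≠] 1) (𝓝 1) := by
  have hinv : ContinuousAt (fun ρ : ℝ => ρ⁻¹) 1 := continuousAt_inv₀ one_ne_zero
  have hinv' : Tendsto (fun ρ : ℝ => ρ⁻¹) (𝓝[≠] 1) (𝓝[≠] 1) := by
    refine tendsto_nhdsWithin_iff.2 ⟨?_, ?_⟩
    · simpa using hinv.tendsto.mono_left (nhdsWithin_le_nhds (s := {1}ᶜ))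
    · filter_upwards [self_mem_nhdsWithin] with ρ hρ
      simpa using hρ
  have h2 : Tendsto (fun ρ : ℝ => ρ⁻¹ ^ 2) (𝓝[≠] 1) (𝓝 1) := by
    have h1 : Tendsto (fun ρ : ℝ => ρ⁻¹) (𝓝[≠] 1) (𝓝 1) :=
      hinv'.mono_right nhdsWithin_le_nhds
    simpa using h1.pow 2
  have h := ((tendsto_logGap_div.comp hinv').mul h2).sub (tendsto_const_mul_pow_four_div D)
  rw [mul_one, sub_zero] at h
  refine h.congr' ?_
  filter_upwards [self_mem_nhdsWithin,
    nhdsWithin_le_nhds (eventually_gt_nhds (zero_lt_one (α := ℝ)))] with ρ hρ hρ0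
  have h3 : 1 - ρ ≠ 0 := sub_ne_zero.2 (Ne.symm hρ)
  have h3' : ρ - 1 ≠ 0 := sub_ne_zero.2 hρ
  have h4 : ρ ≠ 0 := hρ0.ne'
  have h5 : 1 - ρ⁻¹ = -((1 - ρ) * ρ⁻¹) := by field_simp; ring
  simp only [Function.comp, h5, sub_div]
  congr 1
  field_simp

end ExponentialDelay

/-! ### Uniformity in the threshold along the family of rates -/

section RateFamily

variable {lam : ℝ} {rate : ℝ → ℝ}

lemma tendsto_rate_div (hlam : 0 < lam) (hne : ∀ γ : ℝ, 0 < γ → rate γ ≠ lam)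
    (hlim : Tendsto rate atTop (𝓝 lam)) :
    Tendsto (fun γ => rate γ / lam) atTop (𝓝[≠] 1) := by
  refine tendsto_nhdsWithin_iff.2 ⟨?_, ?_⟩
  · simpa [div_self hlam.ne'] using hlim.div_const lam
  · filter_upwards [eventually_gt_atTop 0] with γ hγ
    simpa [div_eq_one_iff_eq hlam.ne'] using hne γ hγ

lemma eventually_half_le_rate (hlam : 0 < lam) (hlim : Tendsto rate atTop (𝓝 lam)) :
    ∀ᶠ γ in atTop, lam / 2 ≤ rate γ :=
  hlim.eventually_const_le (half_lt_self hlam)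

lemma eventually_optimalDelay_mul_le (hlam : 0 < lam) (hne : ∀ γ : ℝ, 0 < γ → rate γ ≠ lam)
    (hlim : Tendsto rate atTop (𝓝 lam)) {a : ℝ} (ha : 0 < a) {θ : ℝ} (hθ : 1 < θ) :
    ∀ᶠ γ in atTop, ∀ ν, 0 < ν → θ * (γ * ((1 - rate γ / lam) ^ 2 / 2)) ≤ expGap ν →
      (optimalDelay (expMeasure lam) (expMeasure (rate γ)) γ).toReal *
        ((1 - rate γ / lam) ^ 2 / 2) ≤ θ * expGap (-(ν + 2 * a)) := by
  have hρ := tendsto_rate_div hlam hne hlim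
  have hθ0 : 0 < θ := by linarith
  filter_upwards [(tendsto_logGap_div.comp hρ).eventually_lt_const hθ,
    ((tendsto_logGap_inv_sub_div (((a ^ 3)⁻¹ + (a ^ 2)⁻¹) *
      (12288 * Real.exp (1 / 2)))).comp hρ).eventually_const_lt (inv_lt_one_of_one_lt₀ hθ),
    eventually_half_le_rate hlam hlim, eventually_gt_atTop 0,
    hρ.eventually self_mem_nhdsWithin] with γ h1 h2 h3 h4 h5 ν hν h
  have hρ1 : 1 - rate γ / lam ≠ 0 := sub_ne_zero.2 (Ne.symm h5)
  have hq : 0 < (1 - rate γ / lam) ^ 2 / 2 := by positivity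
  simp only [Function.comp] at h1 h2
  rw [div_lt_iff₀ hq] at h1
  rw [lt_div_iff₀ hq, inv_mul_lt_iff₀ hθ0] at h2
  exact optimalDelay_expMeasure_mul_le hlam h3 (hne γ h4) ha hν h4.le hθ0 h1.le h2.le h

lemma eventually_le_optimalDelay_mul (hlam : 0 < lam) (hne : ∀ γ : ℝ, 0 < γ → rate γ ≠ lam)
    (hlim : Tendsto rate atTop (𝓝 lam)) {a : ℝ} (ha : 0 < a) {θ : ℝ} (hθ0 : 0 < θ) (hθ : θ < 1) :
    ∀ᶠ γ in atTop, ∀ ν, 0 ≤ ν → expGap ν < θ * (γ * ((1 - rate γ / lam) ^ 2 / 2)) →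
      θ * (expGap (-ν) - (Real.exp a - 1)) ≤
        (optimalDelay (expMeasure lam) (expMeasure (rate γ)) γ).toReal *
          ((1 - rate γ / lam) ^ 2 / 2) := by
  have hρ := tendsto_rate_div hlam hne hlim
  filter_upwards [((tendsto_logGap_inv_sub_div 0).comp hρ).eventually_lt_const
      ((one_lt_inv₀ hθ0).2 hθ),
    ((tendsto_logGap_sub_div ((a ^ 2)⁻¹ *
      (12288 * Real.exp (1 / 2)))).comp hρ).eventually_const_lt hθ,
    eventually_half_le_rate hlam hlim, eventually_gt_atTop 0,
    hρ.eventually self_mem_nhdsWithin] with γ h1 h2 h3 h4 h5 ν hν h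
  have hρ1 : 1 - rate γ / lam ≠ 0 := sub_ne_zero.2 (Ne.symm h5)
  have hq : 0 < (1 - rate γ / lam) ^ 2 / 2 := by positivity
  simp only [Function.comp, zero_mul, sub_zero] at h1 h2
  rw [div_lt_iff₀ hq, lt_inv_mul_iff₀ hθ0] at h1
  rw [lt_div_iff₀ hq] at h2
  exact le_optimalDelay_expMeasure_mul hlam h3 (hne γ h4) ha hν h4 hθ0 h1.le h2.le h

lemma sqrt_mul_abs_sq {γ x : ℝ} (hγ : 0 ≤ γ) : (√γ * |x|) ^ 2 = γ * x ^ 2 := by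
  rw [mul_pow, Real.sq_sqrt hγ, sq_abs]

end RateFamily

end QuickestChange

theorem mainTheorem5 (lam : ℝ) (rate : ℝ → ℝ) (hlam : 0 < lam)
    (hrate_pos : ∀ γ : ℝ, 0 < γ → 0 < rate γ)
    (hrate_ne : ∀ γ : ℝ, 0 < γ → rate γ ≠ lam)
    (hrate_lim : Tendsto rate atTop (𝓝 lam)) :
    (∀ γ : ℝ, 0 < γ →
      QuickestChange.optimalDelay (expMeasure lam) (expMeasure (rate γ)) γ ≠ ∞) ∧
    (Tendsto (fun γ : ℝ => √γ * |1 - rate γ / lam|) atTop atTop →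
      (fun γ : ℝ =>
          (QuickestChange.optimalDelay (expMeasure lam) (expMeasure (rate γ)) γ).toReal)
        ~[atTop]
      (fun γ : ℝ =>
          2 * Real.log (1 / 2 * γ * (1 - rate γ / lam) ^ 2) / (1 - lam / rate γ) ^ 2)) ∧
    (∀ y : ℝ, 0 < y →
      Tendsto (fun γ : ℝ => √γ * |1 - rate γ / lam|) atTop (𝓝 y) →
      (fun γ : ℝ =>
          (QuickestChange.optimalDelay (expMeasure lam) (expMeasure (rate γ)) γ).toReal)
        ~[atTop]
      (fun γ : ℝ => γ * (QuickestChange.G (y ^ 2 / 2) / (y ^ 2 / 2)))) ∧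
    (Tendsto (fun γ : ℝ => √γ * |1 - rate γ / lam|) atTop (𝓝 0) →
      (fun γ : ℝ =>
          (QuickestChange.optimalDelay (expMeasure lam) (expMeasure (rate γ)) γ).toReal)
        ~[atTop]
      (fun γ : ℝ => γ)) := by
  open QuickestChange in
  have hρ := tendsto_rate_div hlam hrate_ne hrate_lim
  set N : ℝ → ℝ := fun γ => (optimalDelay (expMeasure lam) (expMeasure (rate γ)) γ).toReal
    with hN
  set q : ℝ → ℝ := fun γ => (1 - rate γ / lam) ^ 2 / 2 with hq
  have hqpos : ∀ᶠ γ in atTop, 0 < q γ := by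
    filter_upwards [hρ.eventually self_mem_nhdsWithin] with γ h
    have : 1 - rate γ / lam ≠ 0 := sub_ne_zero.2 (Ne.symm h)
    simp only [hq]
    positivity
  have hU : ∀ a, 0 < a → ∀ θ, 1 < θ → ∀ᶠ γ in atTop, ∀ ν, 0 < ν → θ * (γ * q γ) ≤ expGap ν →
      N γ * q γ ≤ θ * expGap (-(ν + 2 * a)) := fun a ha θ hθ =>
    eventually_optimalDelay_mul_le hlam hrate_ne hrate_lim ha hθ
  have hL : ∀ a, 0 < a → ∀ θ, 0 < θ → θ < 1 → ∀ᶠ γ in atTop, ∀ ν, 0 ≤ ν →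
      expGap ν < θ * (γ * q γ) → θ * (expGap (-ν) - (Real.exp a - 1)) ≤ N γ * q γ :=
    fun a ha θ hθ0 hθ => eventually_le_optimalDelay_mul hlam hrate_ne hrate_lim ha hθ0 hθ
  have hXeq : ∀ᶠ γ : ℝ in atTop, (√γ * |1 - rate γ / lam|) ^ 2 / 2 = γ * q γ := by
    filter_upwards [eventually_ge_atTop 0] with γ hγ
    rw [sqrt_mul_abs_sq hγ, hq]
    ring
  refine ⟨fun γ hγ => optimalDelay_expMeasure_ne_top hlam (hrate_pos γ hγ),
    fun h => ?_, fun y hy h => ?_, fun h => ?_⟩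
  · have hX : Tendsto (fun γ => γ * q γ) atTop atTop :=
      ((tendsto_pow_atTop two_ne_zero).comp h |>.atTop_div_const two_pos).congr' hXeq
    have hlog := Real.tendsto_log_atTop.comp hX
    have hmain := tendsto_mul_div_log hX hU hL
    -- The statement divides by `(1 - lam / rate γ)²` whereas `q` contains `(1 - rate γ / lam)²`;
    -- this factor is their quotient.
    have hinv : Tendsto (fun γ => (lam / rate γ) ^ 2) atTop (𝓝 1) := by
      simpa [div_self hlam.ne'] using
        ((tendsto_const_nhds (x := lam)).div hrate_lim hlam.ne').pow 2
    have hprod := hmain.mul hinv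
    rw [mul_one] at hprod
    have hev : ∀ᶠ γ in atTop, 2 * Real.log (1 / 2 * γ * (1 - rate γ / lam) ^ 2) /
        (1 - lam / rate γ) ^ 2 ≠ 0 ∧ N γ * q γ / Real.log (γ * q γ) * (lam / rate γ) ^ 2 =
        N γ / (2 * Real.log (1 / 2 * γ * (1 - rate γ / lam) ^ 2) / (1 - lam / rate γ) ^ 2) := by
      filter_upwards [hlog.eventually_gt_atTop 0, eventually_gt_atTop 0] with γ h1 h2
      have hr := (hrate_pos γ h2).ne'
      have hd : rate γ - lam ≠ 0 := sub_ne_zero.2 (hrate_ne γ h2)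
      have e1 : 1 / 2 * γ * (1 - rate γ / lam) ^ 2 = γ * q γ := by simp only [hq]; ring
      have e2 : 1 - lam / rate γ = (rate γ - lam) / rate γ := by field_simp
      have e3 : q γ = ((rate γ - lam) / lam) ^ 2 / 2 := by
        simp only [hq]; field_simp; ring
      have h1' : Real.log (γ * q γ) ≠ 0 := ne_of_gt h1
      rw [e1, e2]
      refine ⟨by positivity, ?_⟩
      generalize Real.log (γ * q γ) = Λ at h1'
      rw [e3]
      have := hlam.ne'
      field_simp
    exact (isEquivalent_iff_tendsto_one (hev.mono fun γ hγ => hγ.1)).2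
      (hprod.congr' (hev.mono fun γ hγ => hγ.2))
  · have hY : 0 < y ^ 2 / 2 := by positivity
    obtain ⟨ν₀, hν₀, hνY⟩ := exists_expGap_eq hY
    have hX : Tendsto (fun γ => γ * q γ) atTop (𝓝 (expGap ν₀)) := by
      rw [hνY]
      exact ((h.pow 2).div_const 2).congr' hXeq
    have hmain := tendsto_mul_of_tendsto hν₀ hX hU hL
    have hg : 0 < expGap (-ν₀) := by
      have := Real.add_one_lt_exp (neg_ne_zero.2 hν₀.ne')
      unfold expGap; linarith
    rw [← hνY, G_expGap hν₀.le]
    rw [← hνY] at hY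
    -- Dividing `N γ * q γ` by `γ * q γ` cancels `q γ` and leaves `N γ / γ`.
    have hprod := (hmain.div hX hY.ne').div_const (expGap (-ν₀) / expGap ν₀)
    rw [div_self (by positivity)] at hprod
    refine (isEquivalent_iff_tendsto_one ?_).2 (hprod.congr' ?_)
    · filter_upwards [eventually_gt_atTop 0] with γ hγ
      positivity
    · filter_upwards [hqpos, eventually_gt_atTop 0] with γ hqγ hγ
      simp only [Pi.div_apply]
      have := hqγ.ne'
      have := hγ.ne'
      field_simp
  · have hX : Tendsto (fun γ => γ * q γ) atTop (𝓝 0) := by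
      simpa using ((h.pow 2).div_const 2).congr' hXeq
    -- The post-change information is asymptotic to `q γ`, so over `γ` observations it vanishes as
    -- well.
    have hB : Tendsto (fun γ => γ * logGap (rate γ / lam)⁻¹) atTop (𝓝 0) := by
      have h1 := hX.mul ((tendsto_logGap_inv_sub_div 0).comp hρ)
      rw [zero_mul] at h1
      refine h1.congr' ?_
      filter_upwards [hqpos] with γ hqγ
      simp only [Function.comp, zero_mul, sub_zero]
      change γ * q γ * (_ / q γ) = _
      have := hqγ.ne'
      field_simp
    have hmain := tendsto_div_of_tendsto_zero (N := N) (B := fun γ => logGap (rate γ / lam)⁻¹) (by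
      filter_upwards [eventually_gt_atTop 0] with γ hγ
      refine logGap_pos (inv_pos.2 (div_pos (hrate_pos γ hγ) hlam)) ?_
      rw [ne_eq, inv_eq_one, div_eq_one_iff_eq hlam.ne']
      exact hrate_ne γ hγ) hB (by
      filter_upwards [eventually_gt_atTop 0] with γ hγ
      exact optimalDelay_expMeasure_le_add_one hlam (hrate_pos γ hγ) hγ.le) (by
      filter_upwards [eventually_gt_atTop 0, eventually_half_le_rate hlam hrate_lim]
        with γ hγ hγ2 s hs
      exact mul_le_optimalDelay_expMeasure hlam hγ2 hγ hs)
    exact (isEquivalent_iff_tendsto_one (by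
      filter_upwards [eventually_gt_atTop 0] with γ hγ using hγ.ne')).2 hmain
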